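/- Let $\kappa$ be a regular uncountable cardinal. Write ${}^{<\kappa}\omega$ for the set of all functions from an ordinal below $\kappa$ to $\omega$, ordered by the tree order $\subseteq$ (extension of functions). The lexicographic order on ${}^{<\kappa}\omega$ is: $s<_{\mathrm{lex}}t$ iff $s\subsetneq t$, or $s$ and $t$ are $\subseteq$-incomparable and $s(\Delta)<t(\Delta)$, where $\Delta$ is the least $\xi<\min\{\mathrm{dom}(s),\mathrm{dom}(t)\}$ with $s(\xi)\neq t(\xi)$. Let $\mathrm{nacc}(\kappa)$ be the set of all ordinals below $\kappa$ that are $0$ or successors. A streamlined $\kappa$-tree $T\subseteq{}^{<\kappa}\omega$ is a set closed under restrictions of its elements to ordinals such that for every $\alpha<\kappa$ the level $T_\alpha:=\{t\in T\mid \mathrm{dom}(t)=\alpha\}$ is nonempty and of size less than $\kappa$. It is a $\kappa$-Aronszajn tree if it has no $\subseteq$-chain of size $\kappa$, and a $\kappa$-Souslin tree if moreover it has no antichain (set of pairwise $\subseteq$-incomparable nodes) of size $\kappa$. For a set $A$ of ordinals, $T\restriction A:=\{t\in T\mid\mathrm{dom}(t)\in A\}$. A subtree of $T$ is a subset $S\subseteq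 T$ that is downward closed in $(T,\subseteq)$ and has the same height as $T$, that is, $S\cap T_\alpha\neq\emptyset$ for every $\alpha<\kappa$. For $s\in T$ and $i<\omega$, the frozen cone is $$T_{[s,i]}:=\{t\in T\mid t\subseteq s\}\cup\{t\in T\mid s\subseteq t\text{ and }t(\xi)\ge i\text{ whenever }\mathrm{dom}(s)\le\xi<\mathrm{dom}(t)\}.$$ A $\varrho$-modification is a function $\eta:x\to\mathbb Z$, where $x$ is a finite subset of $\mathrm{nacc}(\kappa)$ with $0\in x$; $\varrho$ denotes the set of all of them. For $\eta\in\varrho$ and $\tau\in{}^{<\kappa}\omega$, let $\eta*\tau$ be the function $\beta\mapsto\eta(\max(\mathrm{dom}(\eta)\cap(\beta+1)))+\tau(\beta)$ on $\mathrm{dom}(\tau)$ if all its values are nonnegative, and $\eta*\tau:=\emptyset$ otherwise. The tree $T$ is uniformly $\varrho$-coherent if for all $\alpha<\kappa$ and $s,t\in T_\alpha$ there is $\eta\in\varrho$ with $\eta*t=s$, and $\eta*t\in T$ for all $t\in T$ and $\eta\in\varrho$. A linear order is scattered if $(\mathbb Q,<)$ does not embed into it, and $\sigma$-scattered if it is a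 union of countably many scattered suborders. A linear order is minimal non-$\sigma$-scattered if it is not $\sigma$-scattered and it embeds into each of its non-$\sigma$-scattered suborders. **Proposition.** Let $T\subseteq{}^{<\kappa}\omega$ be a streamlined, uniformly $\varrho$-coherent $\kappa$-Aronszajn tree that is not $\kappa$-Souslin. Suppose that every subtree of $T$ contains some frozen cone $T_{[s,i]}$ with $s\in T\restriction\mathrm{nacc}(\kappa)$ and $i<\omega$. Then for every antichain $X\subseteq T$ of size $\kappa$, the linear order $(X,<_{\mathrm{lex}})$ is minimal non-$\sigma$-scattered. -/

import Mathlib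

open Set
open scoped Cardinal

universe u v

/-! ### Scattered and `σ`-scattered linear orders -/

/-- A linear order is scattered if the rational line does not embed into it. -/
def IsScattered (L : Type v) [LinearOrder L] : Prop :=
  IsEmpty (ℚ ↪o L)

/-- A linear order is `σ`-scattered if it is a union of countably many scattered suborders. -/
def IsSigmaScattered (L : Type v) [LinearOrder L] : Prop :=
  ∃ S : ℕ → Set L, (∀ n, IsScattered (S n)) ∧ (⋃ n, S n) = univ

/-- `L` is minimal with respect to being non-`σ`-scattered: it is not `σ`-scattered, and it
embeds into each of its suborders that is not `σ`-scattered. -/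
def IsMinimalNonSigmaScattered (L : Type v) [LinearOrder L] : Prop :=
  ¬ IsSigmaScattered L ∧ ∀ Y : Set L, ¬ IsSigmaScattered Y → Nonempty (L ↪o Y)

/-! ### Accumulation points of sets of ordinals -/

/-- `acc(C) = {α ∈ C ∣ sup (C ∩ α) = α > 0}`. -/
def acc (C : Set Ordinal.{u}) : Set Ordinal.{u} :=
  {α | α ∈ C ∧ sSup (C ∩ Iio α) = α ∧ 0 < α}

/-- `nacc(C) = C \ acc(C)`. -/
def nacc (C : Set Ordinal.{u}) : Set Ordinal.{u} :=
  C \ acc C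

/-- `nacc(κ)`, the cardinal `κ` being identified with the set of ordinals below it. -/
def naccCard (κ : Cardinal.{u}) : Set Ordinal.{u} :=
  nacc (Iio κ.ord)

/-! ### The set `^{<κ}ω` with its tree order and its lexicographic order -/

/-- An element of `^{<κ}ω`: a function from an ordinal `dom < κ` to `ω`. To have a plain function
at hand, it is stored with the value `0` outside its domain, so that two elements are equal iff
they have the same domain and agree on it. -/
@[ext]
structure Node (κ : Cardinal.{u}) : Type (u + 1) where
  /-- the domain of the function -/
  dom : Ordinal.{u}
  /-- the values of the function -/
  toFun : Ordinal.{u} → ℕ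
  dom_lt : dom < κ.ord
  toFun_eq_zero : ∀ ξ, dom ≤ ξ → toFun ξ = 0

namespace Node

variable {κ : Cardinal.{u}}

/-- The tree order `s ⊆ t`: the function `t` extends the function `s`. -/
def Sub (s t : Node κ) : Prop :=
  s.dom ≤ t.dom ∧ ∀ ξ < s.dom, s.toFun ξ = t.toFun ξ

/-- `t` is an `i`-extension of `s`. -/
def IExt (i : ℕ) (s t : Node κ) : Prop :=
  s.Sub t ∧ ∀ ξ, s.dom ≤ ξ → ξ < t.dom → i ≤ t.toFun ξ

/-- The strict lexicographic order: either `t` properly extends `s`, or `s(Δ) < t(Δ)` where `Δ`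
is the first point of the common domain at which `s` and `t` differ. -/
def LexLT (s t : Node κ) : Prop :=
  (s.Sub t ∧ s ≠ t) ∨
    ∃ Δ, Δ < s.dom ∧ Δ < t.dom ∧ (∀ ξ < Δ, s.toFun ξ = t.toFun ξ) ∧ s.toFun Δ < t.toFun Δ

theorem Sub.antisymm {s t : Node κ} (h : s.Sub t) (h' : t.Sub s) : s = t := by
  have hd : s.dom = t.dom := le_antisymm h.1 h'.1
  ext ξ
  · exact hd
  · by_cases hξ : ξ < s.dom
    · exact h.2 ξ hξ
    · rw [s.toFun_eq_zero ξ (not_lt.1 hξ), t.toFun_eq_zero ξ (hd ▸ not_lt.1 hξ)]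

theorem Sub.trans {r s t : Node κ} (h : r.Sub s) (h' : s.Sub t) : r.Sub t :=
  ⟨h.1.trans h'.1, fun ξ hξ => (h.2 ξ hξ).trans (h'.2 ξ (hξ.trans_le h.1))⟩

theorem LexLT.irrefl (s : Node κ) : ¬ s.LexLT s := by
  rintro (⟨-, h⟩ | ⟨Δ, -, -, -, h⟩)
  · exact h rfl
  · exact lt_irrefl _ h

theorem LexLT.trans {r s t : Node κ} (h : r.LexLT s) (h' : s.LexLT t) : r.LexLT t := by
  rcases h with ⟨h, hne⟩ | ⟨Δ, h1, h2, h3, h4⟩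
  · rcases h' with ⟨h', -⟩ | ⟨Δ', k1, k2, k3, k4⟩
    · refine Or.inl ⟨h.trans h', ?_⟩
      rintro rfl
      exact hne (h.antisymm h')
    · by_cases hr : Δ' < r.dom
      · exact Or.inr ⟨Δ', hr, k2, fun ξ hξ => (h.2 ξ (hξ.trans hr)).trans (k3 ξ hξ),
          (h.2 Δ' hr).trans_lt k4⟩
      · have hr := not_lt.1 hr
        refine Or.inl ⟨⟨hr.trans k2.le, fun ξ hξ => (h.2 ξ hξ).trans (k3 ξ (hξ.trans_le hr))⟩, ?_⟩
        rintro rfl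
        exact hr.not_gt k2
  · rcases h' with ⟨h', -⟩ | ⟨Δ', k1, k2, k3, k4⟩
    · exact Or.inr ⟨Δ, h1, h2.trans_le h'.1,
        fun ξ hξ => (h3 ξ hξ).trans (h'.2 ξ (hξ.trans h2)), h4.trans_eq (h'.2 Δ h2)⟩
    · rcases lt_trichotomy Δ Δ' with hlt | rfl | hlt
      · exact Or.inr ⟨Δ, h1, hlt.trans k2, fun ξ hξ => (h3 ξ hξ).trans (k3 ξ (hξ.trans hlt)),
          h4.trans_eq (k3 Δ hlt)⟩
      · exact Or.inr ⟨Δ, h1, k2, fun ξ hξ => (h3 ξ hξ).trans (k3 ξ hξ), h4.trans k4⟩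
      · exact Or.inr ⟨Δ', hlt.trans h1, k2, fun ξ hξ => (h3 ξ (hξ.trans hlt)).trans (k3 ξ hξ),
          (h3 Δ' hlt).trans_lt k4⟩

theorem LexLT.total {s t : Node κ} (h : ¬ s.LexLT t) (h' : ¬ t.LexLT s) : s = t := by
  by_contra hne
  have key : ∀ ξ, ξ < s.dom → ξ < t.dom → s.toFun ξ = t.toFun ξ := by
    intro ξ
    induction ξ using WellFoundedLT.induction with
    | ind ξ ih =>
      intro hs ht
      have hξ : ∀ ζ < ξ, s.toFun ζ = t.toFun ζ :=
        fun ζ hζ => ih ζ hζ (hζ.trans hs) (hζ.trans ht)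
      rcases lt_trichotomy (s.toFun ξ) (t.toFun ξ) with hlt | heq | hlt
      · exact absurd (Or.inr ⟨ξ, hs, ht, hξ, hlt⟩) h
      · exact heq
      · exact absurd (Or.inr ⟨ξ, ht, hs, fun ζ hζ => (hξ ζ hζ).symm, hlt⟩) h'
  rcases le_total s.dom t.dom with hd | hd
  · exact h (Or.inl ⟨⟨hd, fun ξ hξ => key ξ hξ (hξ.trans_le hd)⟩, hne⟩)
  · exact h' (Or.inl ⟨⟨hd, fun ξ hξ => (key ξ (hξ.trans_le hd) hξ).symm⟩, Ne.symm hne⟩)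

/-- The lexicographic order as a linear order on `^{<κ}ω`; `s < t` is `s.LexLT t`, and subsets
carry the induced order. -/
noncomputable instance : LinearOrder (Node κ) where
  le s t := s = t ∨ s.LexLT t
  lt s t := s.LexLT t
  le_refl s := Or.inl rfl
  le_trans r s t := by
    rintro (rfl | h) (rfl | h')
    · exact Or.inl rfl
    · exact Or.inr h'
    · exact Or.inr h
    · exact Or.inr (h.trans h')
  lt_iff_le_not_ge s t := by
    constructor
    · intro h
      refine ⟨Or.inr h, ?_⟩
      rintro (rfl | h')
      · exact LexLT.irrefl _ h
      · exact LexLT.irrefl _ (h.trans h')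
    · rintro ⟨rfl | h, h'⟩
      · exact absurd (Or.inl rfl) h'
      · exact h
  le_antisymm s t := by
    rintro (rfl | h) h'
    · rfl
    · rcases h' with rfl | h'
      · rfl
      · exact absurd (h.trans h') (LexLT.irrefl _)
  le_total s t := by
    by_cases h : s.LexLT t
    · exact Or.inl (Or.inr h)
    · by_cases h' : t.LexLT s
      · exact Or.inr (Or.inr h')
      · exact Or.inl (Or.inl (LexLT.total h h'))
  toDecidableLE := Classical.decRel _

end Node

/-! ### Streamlined trees -/

section Trees

variable {κ : Cardinal.{u}}

/-- The level `T_α` of a streamlined tree `T`. -/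
def treeLevel (T : Set (Node κ)) (α : Ordinal.{u}) : Set (Node κ) :=
  {t | t ∈ T ∧ t.dom = α}

/-- `T ↾ A`, the nodes of `T` whose height belongs to `A`. -/
def treeRestrict (T : Set (Node κ)) (A : Set Ordinal.{u}) : Set (Node κ) :=
  {t | t ∈ T ∧ t.dom ∈ A}

/-- A streamlined `κ`-tree `T ⊆ ^{<κ}ω`: it contains every restriction of each of its elements to
an ordinal, and for every `α < κ` its level `T_α` is nonempty and of size less than `κ`. -/
structure IsStreamlinedTree (T : Set (Node κ)) : Prop where
  downward_closed : ∀ s t : Node κ, s.Sub t → t ∈ T → s ∈ T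
  level_nonempty : ∀ α < κ.ord, (treeLevel T α).Nonempty
  level_card_lt : ∀ α < κ.ord, #(treeLevel T α) < Cardinal.lift.{u + 1} κ

/-- A streamlined `κ`-Aronszajn tree: no branch (that is, no chain of the tree order) has
size `κ`. -/
def IsAronszajnTree (T : Set (Node κ)) : Prop :=
  IsStreamlinedTree T ∧
    ∀ B ⊆ T, IsChain Node.Sub B → #B ≠ Cardinal.lift.{u + 1} κ

/-- A streamlined `κ`-Souslin tree: a `κ`-Aronszajn tree none of whose antichains has
size `κ`. -/
def IsSouslinTree (T : Set (Node κ)) : Prop :=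
  IsAronszajnTree T ∧
    ∀ X ⊆ T, IsAntichain Node.Sub X → #X ≠ Cardinal.lift.{u + 1} κ

/-- The downward closure of `X` in `T`. -/
def downClosure (T X : Set (Node κ)) : Set (Node κ) :=
  {z | z ∈ T ∧ ∃ x ∈ X, z.Sub x}

/-- The height of a subset `A` of `T`: the least ordinal `α` with `T_α ∩ A = ∅`. Such ordinals
exist, since no node has height `κ`. -/
noncomputable def treeHeight (T A : Set (Node κ)) : Ordinal.{u} :=
  sInf {α | treeLevel T α ∩ A = ∅}

/-- A subtree of `T`: a downward closed subset of `T` of the same height as `T`. -/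
def IsSubtree (T A : Set (Node κ)) : Prop :=
  A ⊆ T ∧ downClosure T A = A ∧ treeHeight T A = treeHeight T T

/-- The frozen cone `T_{[s,i]}`. -/
def frozenCone (T : Set (Node κ)) (s : Node κ) (i : ℕ) : Set (Node κ) :=
  {t | t ∈ T ∧ (t.Sub s ∨ s.IExt i t)}

end Trees

/-! ### `ϱ`-modifications -/

/-- A `ϱ`-modification: a function to `ℤ` from a finite subset of `nacc(κ)` containing `0`.
It is stored with the value `0` outside its domain. -/
structure Modification (κ : Cardinal.{u}) : Type (u + 1) where
  /-- the domain of the modification -/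
  dom : Finset Ordinal.{u}
  /-- the values of the modification -/
  toFun : Ordinal.{u} → ℤ
  zero_mem : 0 ∈ dom
  dom_subset : ∀ β ∈ dom, β ∈ naccCard κ
  toFun_eq_zero : ∀ β, β ∉ dom → toFun β = 0

namespace Modification

variable {κ : Cardinal.{u}}

/-- `β⁻ = max (dom(η) ∩ (β + 1))`. -/
noncomputable def prev (η : Modification κ) (β : Ordinal.{u}) : Ordinal.{u} :=
  (η.dom.filter (· ≤ β)).max' ⟨0, Finset.mem_filter.2 ⟨η.zero_mem, zero_le⟩⟩

/-- `η * τ`: the function `β ↦ η(β⁻) + τ(β)` on `dom(τ)` if all of its values are nonnegative,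
and the empty function otherwise. -/
noncomputable def act (η : Modification κ) (τ : Node κ) : Node κ := by
  classical
  exact
    if ∀ β < τ.dom, 0 ≤ η.toFun (η.prev β) + (τ.toFun β : ℤ) then
      { dom := τ.dom
        toFun := fun β =>
          if β < τ.dom then (η.toFun (η.prev β) + (τ.toFun β : ℤ)).toNat else 0
        dom_lt := τ.dom_lt
        toFun_eq_zero := fun _ hξ => if_neg (not_lt.2 hξ) }
    else
      { dom := 0
        toFun := fun _ => 0
        dom_lt := lt_of_le_of_lt zero_le τ.dom_lt
        toFun_eq_zero := fun _ _ => rfl }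

end Modification

section Coherence

variable {κ : Cardinal.{u}}

/-- `ϱ`-coherence: any two nodes of the same level are modifications of each other. -/
def IsCoherent (T : Set (Node κ)) : Prop :=
  ∀ α < κ.ord, ∀ t ∈ treeLevel T α, ∀ s ∈ treeLevel T α, ∃ η : Modification κ, η.act t = s

/-- `ϱ`-uniformity: `T` is closed under modifications. -/
def IsUniform (T : Set (Node κ)) : Prop :=
  ∀ t ∈ T, ∀ η : Modification κ, η.act t ∈ T

/-- Uniform `ϱ`-coherence. -/
def IsUniformlyCoherent (T : Set (Node κ)) : Prop :=
  IsCoherent T ∧ IsUniform T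

end Coherence

/-!
Two nodes of the tree that are incomparable in the tree order stay so, and in the same
lexicographic order, when they are extended. This is `Node.Branch.mono`, and it makes the order of
an antichain depend only on initial segments of its elements.

*Non-`σ`-scatteredness.* If an antichain `X` of size `κ` is a countable union, then one of the
pieces has unbounded height, by regularity of `κ`. The nodes with unboundedly many extensions in
that piece `A` split again and again into such nodes, since otherwise they would form a branch of
size `κ` (`IsAronszajnTree.exists_branch`). A binary tree of such nodes yields a densely ordered
subset of `A`, so that `A` is not scattered (`not_isScattered_of_splitting`).

*Bounded sets are `σ`-scattered.* By coherence, the difference of a node and a fixed node of at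
least the same height is a step function with finitely many steps. For a given list of values of
the steps, the nodes form a scattered order, as the lengths of the steps are ordinals and the order
depends monotonically or antitonically on the first length at which two nodes differ
(`not_strictMono_of_hasSteps`). There are countably many lists of integers
(`IsCoherent.isSigmaScattered_of_bounded`). Hence a non-`σ`-scattered `Y ⊆ X` has unbounded height,
its downward closure is a subtree, and it includes a frozen cone `T_{[s,i]}` by assumption.

*Minimality.* It remains to map `T` into `T_{[s,i]}` so that incomparable nodes are sent to
incomparable nodes in the same order (`exists_map_into_frozenCone`): the images of the elements of
`X` are then extended to elements of `Y`. Above a level `δ + 1`, where `δ` is a limit ordinal that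
is closed under `x ↦ σ + ω * x` for `σ = dom s`, a node is only shifted by `i`. Below that level it
is replaced with a code (`exists_coding`). The code of `r` is a fixed node `b` of the frozen cone,
changed at the two points `σ + ω * x + 1` and `σ + ω * x + 2` for each of the finitely many jumps
`x` of `r` relative to a fixed node: the first value tells whether `r` jumps upwards or downwards,
the second one is `r x + i`. The direction needs a value of its own, as a jump is to be compared
with the absence of a jump, whose code is the given value of `b`. Jumps occur at points of `nacc(κ)`
only, so that `δ` is never one of them and the codes of all jumps fit in below `δ`. Uniformity
allows to change values at finitely many points of `nacc(κ)` (`IsUniform.mem_of_eq_off_finite`)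
and to put the upper part of one node on top of another node (`IsUniformlyCoherent.glue_mem`).
-/

/-! ### Nodes that split -/

namespace Node

variable {κ : Cardinal.{u}}

/-- `s` and `t` are incomparable in the tree order, and `s` is lexicographically smaller. -/
def Branch (s t : Node κ) : Prop :=
  ∃ Δ, Δ < s.dom ∧ Δ < t.dom ∧ (∀ ξ < Δ, s.toFun ξ = t.toFun ξ) ∧ s.toFun Δ < t.toFun Δ

theorem Branch.lt {s t : Node κ} (h : s.Branch t) : s < t :=
  Or.inr h

theorem Branch.mono {s t s' t' : Node κ} (h : s.Branch t) (hs : s.Sub s') (ht : t.Sub t') :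
    s'.Branch t' := by
  obtain ⟨Δ, h1, h2, h3, h4⟩ := h
  refine ⟨Δ, h1.trans_le hs.1, h2.trans_le ht.1, fun ξ hξ => ?_, ?_⟩
  · rw [← hs.2 ξ (hξ.trans h1), ← ht.2 ξ (hξ.trans h2), h3 ξ hξ]
  · rwa [← hs.2 Δ h1, ← ht.2 Δ h2]

theorem Sub.refl (s : Node κ) : s.Sub s :=
  ⟨le_rfl, fun _ _ => rfl⟩

theorem Sub.le {s t : Node κ} (h : s.Sub t) : s ≤ t := by
  by_cases hst : s = t
  · exact hst.le
  · exact le_of_lt (show s.LexLT t from Or.inl ⟨h, hst⟩)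

theorem branch_of_lt {s t : Node κ} (h : s < t) (hst : ¬ s.Sub t) : s.Branch t :=
  (show s.LexLT t from h).resolve_left fun h => hst h.1

theorem branch_or_branch {s t : Node κ} (h : ¬ s.Sub t) (h' : ¬ t.Sub s) :
    s.Branch t ∨ t.Branch s := by
  rcases lt_trichotomy s t with hlt | rfl | hlt
  · exact Or.inl (branch_of_lt hlt h)
  · exact absurd (Sub.refl s) h
  · exact Or.inr (branch_of_lt hlt h')

/-- The set of all extensions of a node is convex in the lexicographic order. -/
theorem sub_of_le_of_le {p w z v : Node κ} (hw : p.Sub w) (hv : p.Sub v) (h1 : w ≤ z)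
    (h2 : z ≤ v) : p.Sub z := by
  by_contra hpz
  by_cases hzp : z.Sub p
  · have hz : z = w := le_antisymm (hzp.trans hw).le h1
    exact hpz (hz ▸ hw)
  rcases branch_or_branch hpz hzp with h | h
  · exact (h.mono hv (Sub.refl z)).lt.not_ge h2
  · exact (h.mono (Sub.refl z) hw).lt.not_ge h1

/-- The restriction of `t` to `dom t ∩ α`. -/
noncomputable def trunc (t : Node κ) (α : Ordinal.{u}) : Node κ where
  dom := min t.dom α
  toFun ξ := if ξ < min t.dom α then t.toFun ξ else 0
  dom_lt := (min_le_left _ _).trans_lt t.dom_lt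
  toFun_eq_zero _ hξ := if_neg (not_lt.2 hξ)

theorem trunc_apply {t : Node κ} {α ξ : Ordinal.{u}} (h : ξ < t.dom) (h' : ξ < α) :
    (t.trunc α).toFun ξ = t.toFun ξ :=
  if_pos (lt_min h h')

theorem trunc_dom {t : Node κ} {α : Ordinal.{u}} (h : α ≤ t.dom) : (t.trunc α).dom = α :=
  min_eq_right h

theorem trunc_sub (t : Node κ) (α : Ordinal.{u}) : (t.trunc α).Sub t :=
  ⟨min_le_left _ _, fun _ hξ => if_pos hξ⟩

theorem ext_of_lt {s t : Node κ} (hd : s.dom = t.dom)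
    (h : ∀ ξ < s.dom, s.toFun ξ = t.toFun ξ) : s = t :=
  Sub.antisymm ⟨hd.le, h⟩ ⟨hd.ge, fun ξ hξ => (h ξ (hd ▸ hξ)).symm⟩

theorem sub_trunc {s t : Node κ} {α : Ordinal.{u}} (h : s.Sub t) (hα : s.dom ≤ α) :
    s.Sub (t.trunc α) :=
  ⟨le_min h.1 hα, fun ξ hξ => (h.2 ξ hξ).trans
    (trunc_apply (hξ.trans_le h.1) (hξ.trans_le hα)).symm⟩

end Node

/-! ### Modifications and closure properties of uniformly coherent trees -/

section Modifications

variable {κ : Cardinal.{u}}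

theorem zero_mem_naccCard (hκ : ℵ₀ ≤ κ) : 0 ∈ naccCard κ :=
  ⟨(Cardinal.isSuccLimit_ord hκ).bot_lt, fun h => lt_irrefl _ h.2.2⟩

theorem add_one_mem_naccCard {α : Ordinal.{u}} (h : α + 1 < κ.ord) : α + 1 ∈ naccCard κ := by
  refine ⟨h, fun h' => ?_⟩
  have h1 : sSup (Iio κ.ord ∩ Iio (α + 1)) ≤ α :=
    csSup_le' fun x hx => Order.lt_add_one_iff.1 hx.2
  exact absurd (h'.2.1.ge.trans h1) (not_le.2 (Order.lt_add_one_iff.2 le_rfl))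

theorem not_mem_naccCard_of_isSuccLimit {α : Ordinal.{u}} (h : Order.IsSuccLimit α) :
    α ∉ naccCard κ := by
  rintro ⟨h1, h2⟩
  refine h2 ⟨h1, le_antisymm (csSup_le' fun x hx => (mem_Iio.1 hx.2).le) ?_, h.bot_lt⟩
  refine le_of_forall_lt fun x hx => ?_
  have hx' : x + 1 < α := h.add_one_lt hx
  exact (Order.lt_add_one_iff.2 le_rfl).trans_le
    (le_csSup ⟨α, fun y hy => (mem_Iio.1 hy.2).le⟩ ⟨hx'.trans h1, hx'⟩)

namespace Modification

theorem prev_mem_filter (η : Modification κ) (β : Ordinal.{u}) :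
    η.prev β ∈ η.dom.filter (· ≤ β) := by
  unfold prev
  exact Finset.max'_mem _ _

theorem prev_mem (η : Modification κ) (β : Ordinal.{u}) : η.prev β ∈ η.dom :=
  (Finset.mem_filter.1 (η.prev_mem_filter β)).1

theorem prev_le (η : Modification κ) (β : Ordinal.{u}) : η.prev β ≤ β :=
  (Finset.mem_filter.1 (η.prev_mem_filter β)).2

theorem le_prev (η : Modification κ) {β x : Ordinal.{u}} (hx : x ∈ η.dom) (h : x ≤ β) :
    x ≤ η.prev β := by
  have hx' : x ∈ η.dom.filter (· ≤ β) := Finset.mem_filter.2 ⟨hx, h⟩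
  unfold prev
  exact Finset.le_max' _ _ hx'

theorem prev_eq (η : Modification κ) {β x : Ordinal.{u}} (hx : x ∈ η.dom) (h : x ≤ β)
    (h' : ∀ y ∈ η.dom, y ≤ β → y ≤ x) : η.prev β = x :=
  le_antisymm (h' _ (η.prev_mem β) (η.prev_le β)) (η.le_prev hx h)

/-- If all values are nonnegative, `η * τ` is the node one expects. -/
theorem act_eq {η : Modification κ} {τ ρ : Node κ} (hd : ρ.dom = τ.dom)
    (h : ∀ β < τ.dom, (ρ.toFun β : ℤ) = η.toFun (η.prev β) + τ.toFun β) : η.act τ = ρ := by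
  have hpos : ∀ β < τ.dom, 0 ≤ η.toFun (η.prev β) + (τ.toFun β : ℤ) := fun β hβ => by
    rw [← h β hβ]; positivity
  unfold act
  rw [if_pos hpos]
  refine Node.ext_of_lt hd.symm fun β hβ => ?_
  have hβ : β < τ.dom := hβ
  simp only [if_pos hβ]
  rw [← h β hβ, Int.toNat_natCast]

/-- If `η * τ` has the same height as `τ`, it is given by the formula that defines it. -/
theorem act_apply {η : Modification κ} {τ : Node κ} (hd : (η.act τ).dom = τ.dom)
    {β : Ordinal.{u}} (hβ : β < τ.dom) :
    ((η.act τ).toFun β : ℤ) = η.toFun (η.prev β) + τ.toFun β := by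
  by_cases hpos : ∀ β < τ.dom, 0 ≤ η.toFun (η.prev β) + (τ.toFun β : ℤ)
  · unfold act
    rw [if_pos hpos]
    simp only [if_pos hβ]
    exact Int.toNat_of_nonneg (hpos β hβ)
  · unfold act at hd
    rw [if_neg hpos] at hd
    have hd : (0 : Ordinal) = τ.dom := hd
    rw [← hd] at hβ
    exact absurd hβ not_lt_zero

end Modification

variable {T : Set (Node κ)}

theorem IsStreamlinedTree.trunc_mem (hT : IsStreamlinedTree T) {t : Node κ} (ht : t ∈ T)
    (α : Ordinal.{u}) : t.trunc α ∈ T :=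
  hT.downward_closed _ _ (t.trunc_sub α) ht

/-- Any node of a coherent tree differs from any other one, as far as both are defined, by a
modification. -/
theorem IsCoherent.exists_modification (hT : IsStreamlinedTree T) (hC : IsCoherent T)
    {s t : Node κ} (hs : s ∈ T) (ht : t ∈ T) (hd : s.dom ≤ t.dom) :
    ∃ η : Modification κ, ∀ ξ < s.dom, (s.toFun ξ : ℤ) = η.toFun (η.prev ξ) + t.toFun ξ := by
  obtain ⟨η, hη⟩ := hC s.dom s.dom_lt (t.trunc s.dom)
    ⟨hT.trunc_mem ht _, Node.trunc_dom hd⟩ s ⟨hs, rfl⟩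
  refine ⟨η, fun ξ hξ => ?_⟩
  have h1 : (η.act (t.trunc s.dom)).dom = (t.trunc s.dom).dom := by
    rw [hη, Node.trunc_dom hd]
  have h2 := Modification.act_apply h1 (β := ξ) (by rwa [Node.trunc_dom hd])
  rwa [hη, Node.trunc_apply (hξ.trans_le hd) hξ] at h2

/-- The node that follows `s` and, above the height of `s`, equals `t` shifted up by `i`. -/
noncomputable def Node.glue (s t : Node κ) (i : ℕ) : Node κ where
  dom := t.dom
  toFun ξ := if ξ < t.dom then if ξ < s.dom then s.toFun ξ else t.toFun ξ + i else 0
  dom_lt := t.dom_lt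
  toFun_eq_zero _ hξ := if_neg (not_lt.2 hξ)

theorem Node.glue_apply_of_lt {s t : Node κ} {i : ℕ} {ξ : Ordinal.{u}} (h : ξ < t.dom)
    (h' : ξ < s.dom) : (s.glue t i).toFun ξ = s.toFun ξ :=
  (if_pos h).trans (if_pos h')

theorem Node.glue_apply_of_le {s t : Node κ} {i : ℕ} {ξ : Ordinal.{u}} (h : ξ < t.dom)
    (h' : s.dom ≤ ξ) : (s.glue t i).toFun ξ = t.toFun ξ + i :=
  (if_pos h).trans (if_neg (not_lt.2 h'))

theorem Node.sub_glue {s t : Node κ} (i : ℕ) (h : s.dom ≤ t.dom) : s.Sub (s.glue t i) :=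
  ⟨h, fun _ hξ => (Node.glue_apply_of_lt (hξ.trans_le h) hξ).symm⟩

theorem IsUniformlyCoherent.glue_mem (hκ : ℵ₀ ≤ κ) (hT : IsStreamlinedTree T)
    (hU : IsUniformlyCoherent T) {s t : Node κ} (hs : s ∈ T) (ht : t ∈ T) (hd : s.dom ≤ t.dom)
    (hn : s.dom ∈ naccCard κ) (i : ℕ) : s.glue t i ∈ T := by
  classical
  obtain ⟨η, hη⟩ := hU.1.exists_modification hT hs ht hd
  set σ := s.dom
  -- keep `η` below `σ`, and shift by `i` from `σ` on
  let D : Finset Ordinal.{u} := insert 0 (insert σ (η.dom.filter (· < σ)))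
  have hD : ∀ {x}, x ∈ D ↔ x = 0 ∨ x = σ ∨ x ∈ η.dom ∧ x < σ := by
    intro x; simp [D]
  let θ : Modification κ :=
    { dom := D
      toFun := fun x => if x ∈ D then if x < σ then η.toFun x else i else 0
      zero_mem := hD.2 (Or.inl rfl)
      dom_subset := by
        intro β hβ
        rcases hD.1 hβ with rfl | rfl | h
        · exact zero_mem_naccCard hκ
        · exact hn
        · exact η.dom_subset _ h.1
      toFun_eq_zero := fun β hβ => if_neg hβ }
  have hθ : ∀ {x}, x ∈ θ.dom ↔ x = 0 ∨ x = σ ∨ x ∈ η.dom ∧ x < σ := hD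
  rw [← Modification.act_eq (η := θ) (τ := t) (ρ := s.glue t i) rfl]
  · exact hU.2 t ht θ
  intro β hβ
  rcases lt_or_ge β σ with h | h
  · have hp : θ.prev β = η.prev β := by
      refine θ.prev_eq (hθ.2 (Or.inr (Or.inr ⟨η.prev_mem β, (η.prev_le β).trans_lt h⟩)))
        (η.prev_le β) fun y hy hyβ => ?_
      rcases hθ.1 hy with rfl | rfl | h'
      · exact zero_le
      · exact absurd hyβ (not_le.2 h)
      · exact η.le_prev h'.1 hyβ
    have hv : θ.toFun (η.prev β) = η.toFun (η.prev β) :=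
      (if_pos (hp ▸ θ.prev_mem β)).trans (if_pos ((η.prev_le β).trans_lt h))
    rw [hp, hv, Node.glue_apply_of_lt hβ h, hη β h]
  · have hp : θ.prev β = σ := by
      refine θ.prev_eq (hθ.2 (Or.inr (Or.inl rfl))) h fun y hy _ => ?_
      rcases hθ.1 hy with rfl | rfl | h'
      · exact zero_le
      · exact le_rfl
      · exact h'.2.le
    have hv : θ.toFun σ = i :=
      (if_pos (hD.2 (Or.inr (Or.inl rfl)))).trans (if_neg (lt_irrefl σ))
    rw [hp, hv, Node.glue_apply_of_le hβ h]
    push_cast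
    ring

/-- The values of a node of `T` can be changed arbitrarily at a point of `nacc(κ)`. -/
theorem IsUniform.mem_of_eq_off_singleton (hκ : ℵ₀ ≤ κ) (hU : IsUniform T) {s t : Node κ}
    (ht : t ∈ T) (hd : s.dom = t.dom) {x : Ordinal.{u}} (hx : x ∈ naccCard κ)
    (h : ∀ ξ < t.dom, ξ ≠ x → s.toFun ξ = t.toFun ξ) : s ∈ T := by
  classical
  have hx1 : x + 1 ∈ naccCard κ :=
    add_one_mem_naccCard ((Cardinal.isSuccLimit_ord hκ).add_one_lt hx.1)
  let D : Finset Ordinal.{u} := {0, x, x + 1}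
  have hD : ∀ {y}, y ∈ D ↔ y = 0 ∨ y = x ∨ y = x + 1 := by
    intro y; simp [D]
  let θ : Modification κ :=
    { dom := D
      toFun := fun y => if y = x then (s.toFun x : ℤ) - t.toFun x else 0
      zero_mem := hD.2 (Or.inl rfl)
      dom_subset := by
        intro β hβ
        rcases hD.1 hβ with rfl | rfl | rfl
        · exact zero_mem_naccCard hκ
        · exact hx
        · exact hx1
      toFun_eq_zero := fun β hβ => if_neg fun h => hβ (hD.2 (Or.inr (Or.inl h))) }
  have hθ : ∀ {y}, y ∈ θ.dom ↔ y = 0 ∨ y = x ∨ y = x + 1 := hD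
  rw [← Modification.act_eq (η := θ) (τ := t) (ρ := s) hd]
  · exact hU t ht θ
  intro β hβ
  by_cases hβx : β = x
  · subst hβx
    have hp : θ.prev β = β := θ.prev_eq (hθ.2 (Or.inr (Or.inl rfl))) le_rfl fun y _ hy => hy
    have hv : θ.toFun β = (s.toFun β : ℤ) - t.toFun β := if_pos rfl
    rw [hp, hv]
    ring
  · have hp : θ.prev β ≠ x := by
      intro hp
      have hxβ : x < β := lt_of_le_of_ne (hp ▸ θ.prev_le β) (Ne.symm hβx)
      have := θ.le_prev (hθ.2 (Or.inr (Or.inr rfl))) (Order.add_one_le_of_lt hxβ)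
      rw [hp] at this
      exact absurd this (not_le.2 (Order.lt_add_one_iff.2 le_rfl))
    have hv : θ.toFun (θ.prev β) = 0 := if_neg hp
    rw [hv, h β hβ hβx, zero_add]

/-- The values of a node of `T` can be changed arbitrarily at finitely many points of
`nacc(κ)`. -/
theorem IsUniform.mem_of_eq_off_finite (hκ : ℵ₀ ≤ κ) (hU : IsUniform T)
    (F : Finset Ordinal.{u}) : ∀ {s t : Node κ}, t ∈ T → s.dom = t.dom →
    (∀ x ∈ F, x ∈ naccCard κ) → (∀ ξ < t.dom, ξ ∉ F → s.toFun ξ = t.toFun ξ) → s ∈ T := by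
  classical
  induction F using Finset.induction_on with
  | empty =>
    intro s t ht hd _ h
    rwa [Node.ext_of_lt hd fun ξ hξ => h ξ (hd ▸ hξ) (Finset.notMem_empty ξ)]
  | insert x F _ ih =>
    intro s t ht hd hF h
    -- the node that agrees with `s` at `x`, and with `t` elsewhere
    let r : Node κ :=
      { dom := t.dom
        toFun := fun ξ => if ξ < t.dom then if ξ = x then s.toFun ξ else t.toFun ξ else 0
        dom_lt := t.dom_lt
        toFun_eq_zero := fun _ hξ => if_neg (not_lt.2 hξ) }
    have hr : r ∈ T := hU.mem_of_eq_off_singleton hκ ht rfl (hF x (Finset.mem_insert_self x F))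
      fun ξ hξ hξx => (if_pos hξ).trans (if_neg hξx)
    refine ih hr hd (fun y hy => hF y (Finset.mem_insert_of_mem hy)) fun ξ hξ hξF => ?_
    by_cases hξx : ξ = x
    · exact ((if_pos hξ).trans (if_pos hξx)).symm
    · refine (h ξ hξ fun h' => ?_).trans ((if_pos hξ).trans (if_neg hξx)).symm
      rcases Finset.mem_insert.1 h' with h' | h'
      · exact hξx h'
      · exact hξF h'

end Modifications

/-! ### Step functions, and trees of bounded height -/

section Steps

/-- From `γ` up to `e`, the function `d` takes the consecutive values listed in `l`, each on a
nonempty interval on which it is constant and which is maximal as such. -/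
def HasSteps (d : Ordinal.{u} → ℤ) (e : Ordinal.{u}) : List ℤ → Ordinal.{u} → Prop
  | [], γ => γ = e
  | v :: l, γ => ∃ x, γ < x ∧ x ≤ e ∧ (∀ ξ, γ ≤ ξ → ξ < x → d ξ = v) ∧ (x < e → d x ≠ v) ∧
      HasSteps d e l x

/-- A function that is locally constant from the left off a finite set has finitely many steps. -/
theorem exists_hasSteps (d : Ordinal.{u} → ℤ) (e : Ordinal.{u}) (F : Finset Ordinal.{u})
    (hF : ∀ x < e, x ∉ F → ∃ γ < x, ∀ ξ, γ ≤ ξ → ξ < x → d ξ = d x) (γ : Ordinal.{u})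
    (hγ : γ ≤ e) : ∃ l, HasSteps d e l γ := by
  classical
  induction hn : (F.filter (γ < ·)).card using Nat.strong_induction_on generalizing γ with
  | _ n ih =>
  rcases hγ.eq_or_lt with rfl | hγe
  · exact ⟨[], rfl⟩
  -- `x` is the end of the first step
  have hne : {ξ | γ ≤ ξ ∧ (ξ = e ∨ d ξ ≠ d γ)}.Nonempty := ⟨e, hγ, Or.inl rfl⟩
  let x := sInf {ξ | γ ≤ ξ ∧ (ξ = e ∨ d ξ ≠ d γ)}
  have hx : γ ≤ x ∧ (x = e ∨ d x ≠ d γ) := csInf_mem hne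
  have hxe : x ≤ e := csInf_le' ⟨hγ, Or.inl rfl⟩
  have hmin : ∀ ξ, γ ≤ ξ → ξ < x → d ξ = d γ := by
    intro ξ h1 h2
    by_contra h3
    have hle : x ≤ ξ := csInf_le' ⟨h1, Or.inr h3⟩
    exact hle.not_gt h2
  have hγx : γ < x := by
    refine lt_of_le_of_ne hx.1 fun h => ?_
    rcases hx.2 with h' | h'
    · exact hγe.ne (h.trans h')
    · exact h' (by rw [← h])
  rcases hxe.eq_or_lt with hxe' | hxe'
  · exact ⟨[d γ], x, hγx, hxe, hmin, fun h => absurd hxe' h.ne, hxe'⟩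
  have hdx : d x ≠ d γ := hx.2.resolve_left hxe'.ne
  have hxF : x ∈ F := by
    by_contra h
    obtain ⟨γ', h1, h2⟩ := hF x hxe' h
    refine hdx ?_
    rw [← h2 (max γ γ') (le_max_right _ _) (max_lt hγx h1),
      hmin (max γ γ') (le_max_left _ _) (max_lt hγx h1)]
  obtain ⟨l, hl⟩ := ih (F.filter (x < ·)).card (by
    rw [← hn]
    refine Finset.card_lt_card ⟨fun y hy => ?_, fun h => ?_⟩
    · rw [Finset.mem_filter] at hy ⊢
      exact ⟨hy.1, hγx.trans hy.2⟩
    · exact lt_irrefl x (Finset.mem_filter.1 (h (Finset.mem_filter.2 ⟨hxF, hγx⟩))).2) x hxe rfl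
  exact ⟨d γ :: l, x, hγx, hxe, hmin, fun _ => hdx, hl⟩

theorem not_wellFoundedLT_rat : ¬ WellFoundedLT ℚ := by
  intro h
  obtain ⟨m, -, hm⟩ := h.wf.has_min univ ⟨0, mem_univ _⟩
  exact hm (m - 1) (mem_univ _) (by linarith)

/-- A monotone or antitone map from the rational line to the ordinals is constant on some
nondegenerate interval. -/
theorem exists_const_of_monotone_or_antitone {x : ℚ → Ordinal.{u}}
    (hx : Monotone x ∨ Antitone x) : ∃ a b, a < b ∧ ∀ c, a ≤ c → c ≤ b → x c = x a := by
  by_cases h : ∃ a b, a < b ∧ x a = x b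
  · obtain ⟨a, b, hab, he⟩ := h
    refine ⟨a, b, hab, fun c h1 h2 => ?_⟩
    rcases hx with hx | hx
    · exact le_antisymm ((hx h2).trans he.ge) (hx h1)
    · exact le_antisymm (hx h1) (he.le.trans (hx h2))
  push Not at h
  exfalso
  rcases hx with hx | hx
  · have : StrictMono x := fun a b hab => lt_of_le_of_ne (hx hab.le) (h a b hab)
    exact not_wellFoundedLT_rat this.wellFoundedLT
  · have : StrictMono fun q => x (-q) := fun a b hab =>
      lt_of_le_of_ne (hx (neg_le_neg hab.le)) (h (-b) (-a) (neg_lt_neg hab)).symm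
    exact not_wellFoundedLT_rat this.wellFoundedLT

variable {κ : Cardinal.{u}}

/-- The nodes whose difference with `τ` has a given list of steps form a scattered order: the
length of the first step varies monotonically with the node, so that it is constant on an interval
of any copy of the rational line, and the remaining steps are dealt with inductively. -/
theorem not_strictMono_of_hasSteps (τ : Node κ) (l : List ℤ) : ∀ (γ : Ordinal.{u})
    (f : ℚ → Node κ), StrictMono f → (∀ q r, ∀ ξ < γ, (f q).toFun ξ = (f r).toFun ξ) →
    ¬ ∀ q, HasSteps (fun ξ => ((f q).toFun ξ : ℤ) - τ.toFun ξ) (f q).dom l γ := by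
  induction l with
  | nil =>
    intro γ f hf hag h
    refine (hf (show (0 : ℚ) < 1 by norm_num)).ne (Node.ext_of_lt ?_ fun ξ hξ => hag _ _ ξ ?_)
    · exact (h 0).symm.trans (h 1)
    · rwa [show γ = (f 0).dom from h 0]
  | cons v l ih =>
    intro γ f hf hag h
    choose x hγx hxe hxv hxne hxl using h
    -- two of the nodes agree along their common first step
    have hag' : ∀ q r, ∀ ξ < x q, ξ < x r → (f q).toFun ξ = (f r).toFun ξ := by
      intro q r ξ hq hr
      rcases lt_or_ge ξ γ with hξ | hξ
      · exact hag q r ξ hξ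
      · have h1 := hxv q ξ hξ hq
        have h2 := hxv r ξ hξ hr
        simp only at h1 h2
        omega
    have hdir : (∀ q r, x q < x r → f q < f r) ∨ (∀ q r, x q < x r → f r < f q) := by
      cases l with
      | nil =>
        have hxd : ∀ q, x q = (f q).dom := hxl
        refine Or.inl fun q r hqr => show (f q).LexLT (f r) from Or.inl ⟨⟨?_, ?_⟩, ?_⟩
        · rw [← hxd, ← hxd]
          exact hqr.le
        · intro ξ hξ
          rw [← hxd] at hξ
          exact hag' q r ξ hξ (hξ.trans hqr)
        · intro he
          rw [hxd, hxd, he] at hqr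
          exact lt_irrefl _ hqr
      | cons v' l' =>
        have hxd : ∀ q, x q < (f q).dom ∧ ((f q).toFun (x q) : ℤ) - τ.toFun (x q) = v' := by
          intro q
          obtain ⟨y, h1, h2, h3, -⟩ := hxl q
          exact ⟨h1.trans_le h2, h3 (x q) le_rfl h1⟩
        have hvv : v' ≠ v := fun hvv => hxne 0 (hxd 0).1 ((hxd 0).2.trans hvv)
        have hv : ∀ q r, x q < x r → ((f r).toFun (x q) : ℤ) - τ.toFun (x q) = v :=
          fun q r hqr => hxv r (x q) (hγx q).le hqr
        rcases lt_or_gt_of_ne hvv with hlt | hlt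
        · refine Or.inl fun q r hqr => Node.Branch.lt
            ⟨x q, (hxd q).1, hqr.trans_le (hxe r), fun ξ hξ => hag' q r ξ hξ (hξ.trans hqr), ?_⟩
          have h1 := hv q r hqr
          have h2 := (hxd q).2
          omega
        · refine Or.inr fun q r hqr => Node.Branch.lt
            ⟨x q, hqr.trans_le (hxe r), (hxd q).1, fun ξ hξ => hag' r q ξ (hξ.trans hqr) hξ, ?_⟩
          have h1 := hv q r hqr
          have h2 := (hxd q).2
          omega
    have hmono : Monotone x ∨ Antitone x := by
      refine hdir.imp (fun h a b hab => ?_) (fun h a b hab => ?_)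
      · by_contra hlt
        exact (hf.monotone hab).not_gt (h _ _ (not_le.1 hlt))
      · by_contra hlt
        exact (hf.monotone hab).not_gt (h _ _ (not_le.1 hlt))
    obtain ⟨a, b, hab, hc⟩ := exists_const_of_monotone_or_antitone hmono
    have : Nontrivial (Icc a b) :=
      ⟨⟨⟨a, le_rfl, hab.le⟩, ⟨b, hab.le, le_rfl⟩, fun h => hab.ne (congrArg Subtype.val h)⟩⟩
    obtain ⟨g⟩ := Order.embedding_from_countable_to_dense ℚ (Icc a b)
    have hg : ∀ q, x (g q) = x a := fun q => hc _ (g q).2.1 (g q).2.2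
    refine ih (x a) (fun q => f (g q)) (fun q r hqr => hf (g.lt_iff_lt.2 hqr)) ?_ ?_
    · intro q r ξ hξ
      exact hag' _ _ ξ (by rwa [hg]) (by rwa [hg])
    · intro q
      have := hxl (g q)
      rwa [hg] at this

variable {T : Set (Node κ)}

/-- A suborder of a coherent tree whose nodes have bounded height is `σ`-scattered: relative to a
fixed node, each of its nodes is determined by a finite list of integers and a finite list of
ordinals, and there are only countably many lists of integers. -/
theorem IsCoherent.isSigmaScattered_of_bounded (hT : IsStreamlinedTree T) (hC : IsCoherent T)
    {Y : Set (Node κ)} (hY : Y ⊆ T) {ρ : Ordinal.{u}} (hρ : ρ < κ.ord)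
    (hb : ∀ y ∈ Y, y.dom ≤ ρ) : IsSigmaScattered Y := by
  obtain ⟨τ, hτ, hτρ⟩ := hT.level_nonempty ρ hρ
  refine ⟨fun n => {y | HasSteps (fun ξ => (y.1.toFun ξ : ℤ) - τ.toFun ξ) y.1.dom
    (Denumerable.ofNat (List ℤ) n) 0}, fun n => ⟨fun f => ?_⟩, ?_⟩
  · exact not_strictMono_of_hasSteps τ _ 0 (fun q => (f q).1.1) (fun q r hqr => f.lt_iff_lt.2 hqr)
      (fun _ _ ξ hξ => absurd hξ not_lt_zero) fun q => (f q).2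
  · refine eq_univ_of_forall fun y => mem_iUnion.2 ?_
    obtain ⟨η, hη⟩ := hC.exists_modification hT (hY y.2) hτ ((hb y y.2).trans hτρ.ge)
    obtain ⟨l, hl⟩ := exists_hasSteps (fun ξ => (y.1.toFun ξ : ℤ) - τ.toFun ξ) y.1.dom η.dom
      (fun x hx hxη => by
        refine ⟨η.prev x, lt_of_le_of_ne (η.prev_le x) fun h => hxη (h ▸ η.prev_mem x),
          fun ξ h1 h2 => ?_⟩
        have hp : η.prev ξ = η.prev x :=
          η.prev_eq (η.prev_mem x) h1 fun z hz hzξ => η.le_prev hz (hzξ.trans h2.le)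
        simp only [hη x hx, hη ξ (h2.trans hx), hp]
        ring) 0 zero_le
    exact ⟨Encodable.encode l, by simpa using hl⟩

end Steps

/-! ### Sets of nodes of unbounded height -/

section Unbounded

variable {κ : Cardinal.{u}}

/-- The heights of the elements of `A` are unbounded in `κ`. -/
def IsUnboundedSet (A : Set (Node κ)) : Prop :=
  ∀ α < κ.ord, ∃ x ∈ A, α ≤ x.dom

theorem exists_strict_upper_bound (hreg : κ.IsRegular) {S : Set Ordinal.{u}}
    (hS : #S < Cardinal.lift.{u + 1} κ) (h : ∀ α ∈ S, α < κ.ord) :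
    ∃ ρ < κ.ord, ∀ α ∈ S, α < ρ := by
  refine ⟨sSup ((· + 1) '' S), Ordinal.sSup_add_one_lt_of_lt_cof ?_ h, fun α hα => ?_⟩
  · rwa [← Ordinal.lift_cof, hreg.cof_ord]
  · have hb : BddAbove ((· + 1) '' S) := by
      refine ⟨κ.ord, ?_⟩
      rintro _ ⟨β, hβ, rfl⟩
      exact Order.add_one_le_of_lt (h β hβ)
    exact (Order.lt_add_one_iff.2 le_rfl).trans_le (le_csSup hb ⟨α, hα, rfl⟩)

theorem exists_bound_of_not_isUnboundedSet {A : Set (Node κ)} (h : ¬ IsUnboundedSet A) :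
    ∃ α < κ.ord, ∀ x ∈ A, x.dom < α := by
  simpa [IsUnboundedSet] using h

theorem IsUnboundedSet.exists_of_subset_iUnion (hreg : κ.IsRegular) (hunc : ℵ₀ < κ)
    {A : Set (Node κ)} (hA : IsUnboundedSet A) {B : ℕ → Set (Node κ)} (h : A ⊆ ⋃ n, B n) :
    ∃ n, IsUnboundedSet (B n) := by
  by_contra! hB
  choose α hα hb using fun n => exists_bound_of_not_isUnboundedSet (hB n)
  obtain ⟨ρ, hρ, hρα⟩ := exists_strict_upper_bound hreg (S := range α)
    ((Cardinal.mk_le_aleph0_iff.2 (countable_range α).to_subtype).trans_lt (by simpa using hunc))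
    (by rintro _ ⟨n, rfl⟩; exact hα n)
  obtain ⟨x, hx, hxρ⟩ := hA ρ hρ
  obtain ⟨n, hn⟩ := mem_iUnion.1 (h hx)
  exact ((hb n x hn).trans (hρα _ ⟨n, rfl⟩)).not_ge hxρ

variable {T : Set (Node κ)}

theorem IsStreamlinedTree.isUnboundedSet_of_mk_eq (hreg : κ.IsRegular)
    (hT : IsStreamlinedTree T) {X : Set (Node κ)} (hX : X ⊆ T)
    (hc : #X = Cardinal.lift.{u + 1} κ) : IsUnboundedSet X := by
  by_contra h
  obtain ⟨α, hα, hb⟩ := exists_bound_of_not_isUnboundedSet h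
  have hsub : X ⊆ ⋃ β ∈ Iio α, treeLevel T β := fun x hx =>
    mem_biUnion (hb x hx) ⟨hX hx, rfl⟩
  have hlt : #(⋃ β ∈ Iio α, treeLevel T β : Set (Node κ)) < Cardinal.lift.{u + 1} κ := by
    rw [Cardinal.card_biUnion_lt_iff_forall_of_isRegular hreg.lift]
    · exact fun β hβ => hT.level_card_lt β (hβ.trans hα)
    · rw [Cardinal.mk_Iio_ordinal, Cardinal.lift_lt]
      exact Cardinal.lt_ord.1 hα
  exact ((Cardinal.mk_le_mk_of_subset hsub).trans_lt hlt).ne hc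

theorem isSubtree_downClosure (hT : IsStreamlinedTree T) {Y : Set (Node κ)} (hY : Y ⊆ T)
    (hu : IsUnboundedSet Y) : IsSubtree T (downClosure T Y) := by
  have hemp : ∀ A : Set (Node κ), treeLevel T κ.ord ∩ A = ∅ := fun A =>
    eq_empty_of_forall_notMem fun x hx => (x.dom_lt.trans_eq hx.1.2.symm).false
  have hheight : ∀ A : Set (Node κ), (∀ α < κ.ord, (treeLevel T α ∩ A).Nonempty) →
      treeHeight T A = κ.ord := by
    intro A hA
    refine le_antisymm (csInf_le' (hemp A)) (le_csInf ⟨_, hemp A⟩ fun α hα => ?_)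
    by_contra hlt
    exact (hA α (not_le.1 hlt)).ne_empty hα
  refine ⟨fun x hx => hx.1, ?_, ?_⟩
  · ext x
    constructor
    · rintro ⟨hx, y, ⟨-, z, hz, hyz⟩, hxy⟩
      exact ⟨hx, z, hz, hxy.trans hyz⟩
    · exact fun hx => ⟨hx.1, x, hx, Node.Sub.refl x⟩
  · rw [hheight, hheight]
    · intro α hα
      obtain ⟨x, hx⟩ := hT.level_nonempty α hα
      exact ⟨x, hx, hx.1⟩
    · intro α hα
      obtain ⟨y, hy, hαy⟩ := hu α hα
      have := hT.trunc_mem (hY hy) α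
      exact ⟨y.trunc α, ⟨this, Node.trunc_dom hαy⟩, this, y, hy, y.trunc_sub α⟩

/-- Above a node with unboundedly many extensions in `A`, there is such a node at each level. -/
theorem IsStreamlinedTree.exists_unbounded_extension (hreg : κ.IsRegular)
    (hT : IsStreamlinedTree T) {A : Set (Node κ)} (hA : A ⊆ T) {p : Node κ}
    (hp : IsUnboundedSet {x ∈ A | p.Sub x}) {α : Ordinal.{u}} (hα : α < κ.ord)
    (hpα : p.dom ≤ α) :
    ∃ q, q.dom = α ∧ p.Sub q ∧ IsUnboundedSet {x ∈ A | q.Sub x} := by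
  by_contra! h
  have hb : ∀ q : treeLevel T α, ∃ β < κ.ord, p.Sub q.1 → ∀ x ∈ A, q.1.Sub x → x.dom < β := by
    intro q
    by_cases hpq : p.Sub q.1
    · obtain ⟨β, hβ, hx⟩ := exists_bound_of_not_isUnboundedSet (h q.1 q.2.2 hpq)
      exact ⟨β, hβ, fun _ x hxA hqx => hx x ⟨hxA, hqx⟩⟩
    · exact ⟨α, hα, fun h => absurd h hpq⟩
  choose β hβ hβx using hb
  obtain ⟨ρ, hρ, hρβ⟩ := exists_strict_upper_bound hreg (S := range β)
    (Cardinal.mk_range_le.trans_lt (hT.level_card_lt α hα)) (by rintro _ ⟨q, rfl⟩; exact hβ q)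
  obtain ⟨x, ⟨hxA, hpx⟩, hx⟩ := hp (max α ρ) (max_lt hα hρ)
  have hαx : α ≤ x.dom := (le_max_left _ _).trans hx
  let q : treeLevel T α := ⟨x.trunc α, hT.trunc_mem (hA hxA) α, Node.trunc_dom hαx⟩
  exact ((hβx q (Node.sub_trunc hpx hpα) x hxA (x.trunc_sub α)).trans (hρβ _ ⟨q, rfl⟩)).not_ge
    ((le_max_right _ _).trans hx)

/-- In an Aronszajn tree, the nodes with unboundedly many extensions in `A` split into two such
nodes, since otherwise they would form a branch of size `κ`. -/
theorem IsAronszajnTree.exists_branch (hreg : κ.IsRegular) (hT : IsAronszajnTree T)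
    {A : Set (Node κ)} (hA : A ⊆ T) {p : Node κ} (hp : IsUnboundedSet {x ∈ A | p.Sub x}) :
    ∃ q r : Node κ, p.Sub q ∧ p.Sub r ∧ q.Branch r ∧ IsUnboundedSet {x ∈ A | q.Sub x} ∧
      IsUnboundedSet {x ∈ A | r.Sub x} := by
  by_contra! h
  let B : Set (Node κ) := {q | p.Sub q ∧ IsUnboundedSet {x ∈ A | q.Sub x}}
  have hcomp : ∀ q ∈ B, ∀ r ∈ B, q.Sub r ∨ r.Sub q := by
    intro q hq r hr
    by_contra! hqr
    rcases Node.branch_or_branch hqr.1 hqr.2 with hb | hb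
    · exact h q r hq.1 hr.1 hb hq.2 hr.2
    · exact h r q hr.1 hq.1 hb hr.2 hq.2
  have hBT : B ⊆ T := by
    intro q hq
    obtain ⟨x, hx, -⟩ := hq.2 0 hreg.ord_pos
    exact hT.1.downward_closed _ _ hx.2 (hA hx.1)
  have hinj : InjOn Node.dom B := by
    intro q hq r hr hqr
    rcases hcomp q hq r hr with hs | hs
    · exact Node.ext_of_lt hqr hs.2
    · exact (Node.ext_of_lt hqr.symm hs.2).symm
  refine hT.2 B hBT (fun q hq r hr _ => hcomp q hq r hr) (le_antisymm ?_ ?_)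
  · rw [← Cardinal.mk_image_eq_of_injOn _ _ hinj]
    refine (Cardinal.mk_le_mk_of_subset (t := Iio κ.ord) ?_).trans_eq ?_
    · rintro _ ⟨q, -, rfl⟩
      exact q.dom_lt
    · rw [Cardinal.mk_Iio_ordinal, Cardinal.card_ord]
  · by_contra! hlt
    obtain ⟨ρ, hρ, hρB⟩ := exists_strict_upper_bound hreg (S := Node.dom '' B)
      (Cardinal.mk_image_le.trans_lt hlt) (by rintro _ ⟨q, -, rfl⟩; exact q.dom_lt)
    obtain ⟨q, hq, hpq, hqA⟩ := hT.1.exists_unbounded_extension hreg hA hp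
      (max_lt p.dom_lt hρ) (le_max_left _ _)
    exact ((hρB _ ⟨q, ⟨hpq, hqA⟩, rfl⟩).trans_eq' hq).not_ge (le_max_right _ _)

end Unbounded

/-! ### Copies of the rational line -/

section Rationals

variable {κ : Cardinal.{u}}

/-- If each node of `P` extends to three pairwise incomparable nodes of `P` and to a point of
`A`, then `A` is not scattered. A binary tree of nodes of `P` is built by passing to the left and
to the right one of the three extensions; the points of `A` picked above the middle ones form a
densely ordered set. -/
theorem not_isScattered_of_splitting {A P : Set (Node κ)} (hP : P.Nonempty)
    (hA : ∀ p ∈ P, ∃ x ∈ A, p.Sub x)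
    (hsplit : ∀ p ∈ P, ∃ a ∈ P, ∃ b ∈ P, ∃ c ∈ P, p.Sub a ∧ p.Sub b ∧ p.Sub c ∧
      a.Branch b ∧ b.Branch c) : ¬ IsScattered A := by
  obtain ⟨p₀, hp₀⟩ := hP
  have hsplit' : ∀ p : P, ∃ a b c : P, p.1.Sub a.1 ∧ p.1.Sub b.1 ∧ p.1.Sub c.1 ∧
      a.1.Branch b.1 ∧ b.1.Branch c.1 := by
    rintro ⟨p, hp⟩
    obtain ⟨a, ha, b, hb, c, hc, h⟩ := hsplit p hp
    exact ⟨⟨a, ha⟩, ⟨b, hb⟩, ⟨c, hc⟩, h⟩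
  choose lo mid hi hlo hmid hhi hlm hmh using hsplit'
  choose pt hptA hpt using fun p : P => hA p.1 p.2
  let step : Bool → P → P := fun b p => if b then hi p else lo p
  let f : List Bool → P := fun l => l.foldr step ⟨p₀, hp₀⟩
  let x : List Bool → A := fun l => ⟨pt (mid (f l)), hptA _⟩
  have hstep : ∀ (b : Bool) (p : P), p.1.Sub (step b p).1 := by
    intro b p
    cases b
    · exact hlo p
    · exact hhi p
  have hmidx : ∀ l, (mid (f l)).1.Sub (x l).1 := fun l => hpt _
  have hfx : ∀ l, (f l).1.Sub (x l).1 := fun l => (hmid _).trans (hmidx l)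
  have happ : ∀ k l, (f l).1.Sub (f (k ++ l)).1 := by
    intro k l
    induction k with
    | nil => exact Node.Sub.refl _
    | cons b k ih => exact ih.trans (hstep b (f (k ++ l)))
  -- the incomparability of the three extensions
  have hincomp : ∀ (b : Bool) (p : P) (z : Node κ), (step b p).1.Sub z → ¬ (mid p).1.Sub z := by
    intro b p z h1 h2
    cases b
    · exact ((hlm p).mono h1 h2).lt.false
    · exact ((hmh p).mono h2 h1).lt.false
  have hincomp' : ∀ (b c : Bool) (p : P) (z : Node κ), (step b p).1.Sub z → (step c p).1.Sub z → b = c := by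
    intro b c p z h1 h2
    have hlh : (lo p).1.Sub z → ¬ (hi p).1.Sub z := fun h1 h2 =>
      (((hlm p).mono h1 (hpt _)).lt.trans ((hmh p).mono (hpt _) h2).lt).false
    cases b <;> cases c
    · rfl
    · exact absurd h2 (hlh h1)
    · exact absurd h1 (hlh h2)
    · rfl
  have hsuff : ∀ l' l, (f l').1.Sub (x l).1 → l' <:+ l := by
    intro l'
    induction l' with
    | nil => exact fun l _ => List.nil_suffix
    | cons b m ih =>
      intro l hl
      obtain ⟨k, rfl⟩ := ih l ((hstep b (f m)).trans hl)
      rcases List.eq_nil_or_concat k with rfl | ⟨k', c, rfl⟩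
      · exact absurd (hmidx m) (hincomp b (f m) _ hl)
      · rw [List.concat_append] at hl ⊢
        have hc : (f (c :: m)).1.Sub (x (k' ++ c :: m)).1 := (happ k' (c :: m)).trans (hfx _)
        have hbc := hincomp' b c (f m) _ hl hc
        exact ⟨k', by simp [hbc]⟩
  have hleft : ∀ l, x (false :: l) < x l := fun l =>
    ((hlm (f l)).mono (hfx (false :: l)) (hmidx l)).lt
  have hright : ∀ l, x l < x (true :: l) := fun l =>
    ((hmh (f l)).mono (hmidx l) (hfx (true :: l))).lt
  have hdense : ∀ l l', x l < x l' → ∃ m, x l < x m ∧ x m < x l' := by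
    intro l l' hll
    by_cases hs : l' <:+ l
    · -- `l` is not a suffix of `l'`, so that `x l'` is above all points that extend `f l`
      have hns : ¬ (f l).1.Sub (x l').1 := by
        intro h
        have := hs.eq_of_length_le (hsuff l l' h).length_le
        rw [this] at hll
        exact hll.false
      refine ⟨true :: l, hright l, ?_⟩
      by_contra hle
      exact hns (Node.sub_of_le_of_le (hfx l)
        ((hstep true (f l)).trans (hfx (true :: l))) hll.le (not_lt.1 hle))
    · have hns : ¬ (f l').1.Sub (x l).1 := fun h => hs (hsuff l' l h)
      refine ⟨false :: l', ?_, hleft l'⟩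
      by_contra hle
      exact hns (Node.sub_of_le_of_le
        ((hstep false (f l')).trans (hfx (false :: l'))) (hfx l') (not_lt.1 hle) hll.le)
  have : DenselyOrdered (range x) := by
    refine ⟨?_⟩
    rintro ⟨_, l, rfl⟩ ⟨_, l', rfl⟩ h
    obtain ⟨m, h1, h2⟩ := hdense l l' h
    exact ⟨⟨x m, m, rfl⟩, h1, h2⟩
  have : Nontrivial (range x) :=
    ⟨⟨⟨x [false], _, rfl⟩, ⟨x [], _, rfl⟩, fun h => (hleft []).ne (congrArg Subtype.val h)⟩⟩
  obtain ⟨g⟩ := Order.embedding_from_countable_to_dense ℚ (range x)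
  exact fun h => h.false (g.trans (OrderEmbedding.subtype _))

/-- In an Aronszajn tree, a set of nodes of unbounded height is not scattered. -/
theorem IsAronszajnTree.not_isScattered (hreg : κ.IsRegular) {T : Set (Node κ)}
    (hT : IsAronszajnTree T) {A : Set (Node κ)} (hA : A ⊆ T) (hu : IsUnboundedSet A) :
    ¬ IsScattered A := by
  let P : Set (Node κ) := {p | IsUnboundedSet {x ∈ A | p.Sub x}}
  refine not_isScattered_of_splitting (P := P) ?_ ?_ ?_
  · obtain ⟨p, hp, hpd⟩ := hT.1.level_nonempty 0 hreg.ord_pos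
    refine ⟨p, fun α hα => ?_⟩
    obtain ⟨x, hx, hαx⟩ := hu α hα
    exact ⟨x, ⟨hx, hpd.trans_le zero_le, fun ξ hξ => absurd (hξ.trans_eq hpd) not_lt_zero⟩, hαx⟩
  · intro p hp
    obtain ⟨x, hx, -⟩ := hp 0 hreg.ord_pos
    exact ⟨x, hx⟩
  · intro p hp
    obtain ⟨q, c, hq, hc, hqc, hqA, hcA⟩ := hT.exists_branch hreg hA hp
    obtain ⟨a, b, ha, hb, hab, haA, hbA⟩ := hT.exists_branch hreg hA hqA
    exact ⟨a, haA, b, hbA, c, hcA, hq.trans ha, hq.trans hb, hc, hab, hqc.mono hb (Node.Sub.refl c)⟩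

end Rationals

/-! ### Jumps of a node relative to another one -/

section Jumps

variable {κ : Cardinal.{u}}

namespace Node

/-- The integer-valued difference of two nodes. -/
def diff (τ r : Node κ) (ξ : Ordinal.{u}) : ℤ :=
  (r.toFun ξ : ℤ) - τ.toFun ξ

/-- `x` is a jump of `r` relative to `τ`: there is no final segment of the ordinals below `x` on
which the difference of `r` and `τ` has the same value as at `x`. In particular, `0` is a jump. -/
def IsJump (τ r : Node κ) (x : Ordinal.{u}) : Prop :=
  ∀ γ < x, ∃ ξ, γ ≤ ξ ∧ ξ < x ∧ diff τ r ξ ≠ diff τ r x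

/-- `r` jumps upwards at `x` relative to `τ`. -/
def IsUpJump (τ r : Node κ) (x : Ordinal.{u}) : Prop :=
  ∃ γ < x, ∀ ξ, γ ≤ ξ → ξ < x → diff τ r ξ < diff τ r x

theorem isJump_congr {τ r r' : Node κ} {x : Ordinal.{u}}
    (h : ∀ ξ ≤ x, r.toFun ξ = r'.toFun ξ) : IsJump τ r x ↔ IsJump τ r' x := by
  have hd : ∀ ξ ≤ x, diff τ r ξ = diff τ r' ξ := fun ξ hξ => by simp only [diff, h ξ hξ]
  refine forall₂_congr fun γ _ => exists_congr fun ξ => and_congr_right fun _ =>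
    and_congr_right fun hξ => ?_
  rw [hd ξ hξ.le, hd x le_rfl]

theorem isUpJump_congr {τ r r' : Node κ} {x : Ordinal.{u}}
    (h : ∀ ξ ≤ x, r.toFun ξ = r'.toFun ξ) : IsUpJump τ r x ↔ IsUpJump τ r' x := by
  have hd : ∀ ξ ≤ x, diff τ r ξ = diff τ r' ξ := fun ξ hξ => by simp only [diff, h ξ hξ]
  refine exists_congr fun γ => and_congr_right fun _ => forall_congr' fun ξ => forall_congr' fun _ =>
    forall_congr' fun hξ => ?_
  rw [hd ξ hξ.le, hd x le_rfl]

theorem isJump_iff {τ r : Node κ} {γ x : Ordinal.{u}} {v : ℤ} (hγ : γ < x)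
    (hv : ∀ ξ, γ ≤ ξ → ξ < x → diff τ r ξ = v) : IsJump τ r x ↔ v ≠ diff τ r x := by
  constructor
  · intro h
    obtain ⟨ξ, h1, h2, h3⟩ := h γ hγ
    rwa [hv ξ h1 h2] at h3
  · intro h γ' hγ'
    refine ⟨max γ γ', le_max_right _ _, max_lt hγ hγ', ?_⟩
    rwa [hv _ (le_max_left _ _) (max_lt hγ hγ')]

theorem isUpJump_iff {τ r : Node κ} {γ x : Ordinal.{u}} {v : ℤ} (hγ : γ < x)
    (hv : ∀ ξ, γ ≤ ξ → ξ < x → diff τ r ξ = v) : IsUpJump τ r x ↔ v < diff τ r x := by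
  constructor
  · rintro ⟨γ', hγ', h⟩
    have := h (max γ γ') (le_max_right _ _) (max_lt hγ hγ')
    rwa [hv _ (le_max_left _ _) (max_lt hγ hγ')] at this
  · exact fun h => ⟨γ, hγ, fun ξ h1 h2 => by rwa [hv ξ h1 h2]⟩

/-- The first difference of two nodes is a jump of at least one of them. -/
theorem isJump_or_isJump {τ r r' : Node κ} {x : Ordinal.{u}}
    (h : ∀ ξ < x, r.toFun ξ = r'.toFun ξ) (hx : r.toFun x ≠ r'.toFun x) :
    IsJump τ r x ∨ IsJump τ r' x := by
  by_contra! hj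
  simp only [IsJump, not_forall, not_exists, not_and, ne_eq, not_not] at hj
  obtain ⟨⟨γ, hγ, h1⟩, γ', hγ', h2⟩ := hj
  have hm := max_lt hγ hγ'
  have e1 := h1 (max γ γ') (le_max_left _ _) hm
  have e2 := h2 (max γ γ') (le_max_right _ _) hm
  simp only [diff, h _ hm] at e1 e2
  omega

end Node

variable {τ r : Node κ} {η : Modification κ}

theorem Modification.mem_dom_of_isJump
    (hη : ∀ ξ < r.dom, (r.toFun ξ : ℤ) = η.toFun (η.prev ξ) + τ.toFun ξ) {x : Ordinal.{u}}
    (hx : x < r.dom) (hj : Node.IsJump τ r x) : x ∈ η.dom := by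
  by_contra hxη
  obtain ⟨ξ, h1, h2, h3⟩ := hj (η.prev x)
    (lt_of_le_of_ne (η.prev_le x) fun h => hxη (h ▸ η.prev_mem x))
  have hp : η.prev ξ = η.prev x :=
    η.prev_eq (η.prev_mem x) h1 fun z hz hzξ => η.le_prev hz (hzξ.trans h2.le)
  apply h3
  simp only [Node.diff, hη x hx, hη ξ (h2.trans hx), hp]
  ring

theorem Modification.exists_const_below
    (hη : ∀ ξ < r.dom, (r.toFun ξ : ℤ) = η.toFun (η.prev ξ) + τ.toFun ξ) {x : Ordinal.{u}}
    (hx : x < r.dom) (hx0 : 0 < x) :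
    ∃ γ < x, ∃ v : ℤ, ∀ ξ, γ ≤ ξ → ξ < x → Node.diff τ r ξ = v := by
  classical
  have hne : (η.dom.filter (· < x)).Nonempty := ⟨0, Finset.mem_filter.2 ⟨η.zero_mem, hx0⟩⟩
  have hm := Finset.mem_filter.1 (Finset.max'_mem _ hne)
  refine ⟨_, hm.2, η.toFun ((η.dom.filter (· < x)).max' hne), fun ξ h1 h2 => ?_⟩
  have hp : η.prev ξ = (η.dom.filter (· < x)).max' hne :=
    η.prev_eq hm.1 h1 fun z hz hzξ => by
      have hzx : z ∈ η.dom.filter (· < x) := Finset.mem_filter.2 ⟨hz, hzξ.trans_lt h2⟩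
      exact Finset.le_max' _ _ hzx
  simp only [Node.diff, hη ξ (h2.trans hx), hp]
  ring

end Jumps

/-! ### The points that carry the codes -/

section Coding

open Ordinal

/-- The point at which the direction of a jump at `x` is coded. The value of the node at `x` is
coded at the successor of this point. -/
noncomputable def codePoint (σ x : Ordinal.{u}) : Ordinal.{u} :=
  σ + ω * x + 1

theorem codePoint_add_one_lt {σ x y : Ordinal.{u}} (h : x < y) :
    codePoint σ x + 1 < codePoint σ y := by
  have h1 : ω * x + 1 + 1 < ω * (x + 1) := by
    rw [← Order.succ_eq_add_one x, mul_succ, add_assoc, one_add_one_eq_two]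
    exact (add_lt_add_iff_left _).2 (natCast_lt_omega0 2)
  have h2 : ω * (x + 1) ≤ ω * y := mul_le_mul_right (Order.add_one_le_of_lt h) ω
  have h3 : σ + (ω * x + 1 + 1) < σ + ω * y := (add_lt_add_iff_left _).2 (h1.trans_le h2)
  simp only [codePoint]
  rw [add_assoc σ, add_assoc σ]
  exact h3.trans (Order.lt_add_one_iff.2 le_rfl)

theorem codePoint_strictMono (σ : Ordinal.{u}) : StrictMono (codePoint σ) := fun _ _ h =>
  (lt_add_one _).trans (codePoint_add_one_lt h)

theorem codePoint_add_one_injective (σ : Ordinal.{u}) :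
    Function.Injective fun x => codePoint σ x + 1 := by
  refine StrictMono.injective fun x y h => ?_
  exact (codePoint_add_one_lt h).trans (lt_add_one _)

theorem codePoint_ne_codePoint_add_one (σ x y : Ordinal.{u}) :
    codePoint σ x ≠ codePoint σ y + 1 := by
  rcases lt_trichotomy x y with h | rfl | h
  · exact ((codePoint_strictMono σ h).trans (lt_add_one _)).ne
  · exact (lt_add_one _).ne
  · exact (codePoint_add_one_lt h).ne'

theorem le_codePoint (σ x : Ordinal.{u}) : σ ≤ codePoint σ x :=
  (le_self_add).trans (lt_add_one _).le

/-- There is a limit ordinal that bounds `σ` and is closed under `codePoint σ`. -/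
theorem exists_limit_closed {κ : Cardinal.{u}} (hreg : κ.IsRegular) (hunc : ℵ₀ < κ)
    {σ : Ordinal.{u}} (hσ : σ < κ.ord) :
    ∃ δ < κ.ord, Order.IsSuccLimit δ ∧ σ ≤ δ ∧ ∀ x < δ, codePoint σ x + 1 < δ := by
  have hlim := Cardinal.isSuccLimit_ord hreg.aleph0_le
  have hn : Order.IsNormal fun x : Ordinal.{u} => σ + ω * x :=
    (isNormal_add_right σ).comp (isNormal_mul_right omega0_pos)
  have hω : ω < κ.ord := by rw [← Cardinal.ord_aleph0]; exact Cardinal.ord_lt_ord.2 hunc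
  have hlt : ∀ x < κ.ord, σ + ω * x < κ.ord := fun x hx =>
    isPrincipal_add_ord hreg.aleph0_le hσ (isPrincipal_mul_ord hreg.aleph0_le hω hx)
  let δ := nfp (fun x => σ + ω * x) 1
  have hfix : σ + ω * δ = δ := nfp_fp hn 1
  have hδ0 : 0 < δ := zero_lt_one.trans_le (le_nfp _ 1)
  have hδ : Order.IsSuccLimit δ := by
    rw [← hfix]
    exact isSuccLimit_add σ (isSuccLimit_mul_left isSuccLimit_omega0 hδ0)
  refine ⟨δ, Cardinal.nfp_lt_ord_of_isRegular hreg hunc.ne' hlt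
    (one_lt_of_isSuccLimit hlim), hδ, le_self_add.trans_eq hfix, fun x hx => ?_⟩
  refine hδ.add_one_lt (hδ.add_one_lt ?_)
  exact (hn.strictMono hx).trans_eq hfix

end Coding

/-! ### Coding nodes inside a frozen cone -/

section Encode

variable {κ : Cardinal.{u}}

open Classical in
/-- The value that codes the direction of a possible jump of `r` at `x` relative to `τ`: it is the
value of `b` at `codePoint σ x` if there is no jump, and a larger or a smaller value for a jump
upwards or downwards. -/
noncomputable def directionCode (σ : Ordinal.{u}) (i : ℕ) (τ b r : Node κ) (x : Ordinal.{u}) : ℕ :=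
  if x < r.dom ∧ Node.IsJump τ r x then
    if Node.IsUpJump τ r x then b.toFun (codePoint σ x) + 1 else i
  else b.toFun (codePoint σ x)

open Classical in
/-- The value that follows `directionCode`: if `r` jumps at `x`, it determines `r x`. -/
noncomputable def valueCode (σ : Ordinal.{u}) (i : ℕ) (τ b r : Node κ) (x : Ordinal.{u}) : ℕ :=
  if x < r.dom ∧ Node.IsJump τ r x then r.toFun x + i else b.toFun (codePoint σ x + 1)

open Classical in
/-- The node of the height of `b` that codes the jumps of `r` relative to `τ`: it is obtained from
`b` by changing the values at `codePoint σ x` and its successor for each jump `x` of `r`. -/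
noncomputable def encode (σ : Ordinal.{u}) (i : ℕ) (τ b r : Node κ) : Node κ where
  dom := b.dom
  toFun ζ := if ζ < b.dom then
      Function.extend (codePoint σ) (directionCode σ i τ b r)
        (Function.extend (fun x => codePoint σ x + 1) (valueCode σ i τ b r) b.toFun) ζ
    else 0
  dom_lt := b.dom_lt
  toFun_eq_zero _ hξ := if_neg (not_lt.2 hξ)

variable {σ : Ordinal.{u}} {i : ℕ} {τ b r r' : Node κ}

theorem encode_codePoint {x : Ordinal.{u}} (h : codePoint σ x < b.dom) :
    (encode σ i τ b r).toFun (codePoint σ x) = directionCode σ i τ b r x :=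
  (if_pos h).trans ((codePoint_strictMono σ).injective.extend_apply _ _ x)

theorem encode_codePoint_add_one {x : Ordinal.{u}} (h : codePoint σ x + 1 < b.dom) :
    (encode σ i τ b r).toFun (codePoint σ x + 1) = valueCode σ i τ b r x := by
  refine (if_pos h).trans ?_
  rw [Function.extend_apply' _ _ _ fun ⟨y, hy⟩ => codePoint_ne_codePoint_add_one σ y x hy]
  exact (codePoint_add_one_injective σ).extend_apply _ _ x

theorem encode_of_ne {ζ : Ordinal.{u}} (h : ζ < b.dom) (h1 : ∀ x, codePoint σ x ≠ ζ)
    (h2 : ∀ x, codePoint σ x + 1 ≠ ζ) : (encode σ i τ b r).toFun ζ = b.toFun ζ := by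
  refine (if_pos h).trans ?_
  rw [Function.extend_apply' _ _ _ fun ⟨y, hy⟩ => h1 y hy,
    Function.extend_apply' _ _ _ fun ⟨y, hy⟩ => h2 y hy]

/-- A pointwise property of the values of `encode σ i τ b r` follows from one of the codes and one
of the values of `b`. -/
theorem encode_cases {motive : Ordinal.{u} → ℕ → ℕ → Prop} {ζ : Ordinal.{u}} (h : ζ < b.dom)
    (h1 : ∀ x, codePoint σ x = ζ →
      motive ζ (directionCode σ i τ b r x) (directionCode σ i τ b r' x))
    (h2 : ∀ x, codePoint σ x + 1 = ζ →
      motive ζ (valueCode σ i τ b r x) (valueCode σ i τ b r' x))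
    (h3 : (∀ x, codePoint σ x ≠ ζ) → (∀ x, codePoint σ x + 1 ≠ ζ) →
      motive ζ (b.toFun ζ) (b.toFun ζ)) :
    motive ζ ((encode σ i τ b r).toFun ζ) ((encode σ i τ b r').toFun ζ) := by
  by_cases hx : ∃ x, codePoint σ x = ζ
  · obtain ⟨x, hx⟩ := hx
    have := h1 x hx
    subst hx
    rwa [encode_codePoint h, encode_codePoint h]
  by_cases hy : ∃ x, codePoint σ x + 1 = ζ
  · obtain ⟨x, hx⟩ := hy
    have := h2 x hx
    subst hx
    rwa [encode_codePoint_add_one h, encode_codePoint_add_one h]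
  push Not at hx hy
  rw [encode_of_ne h hx hy, encode_of_ne h hx hy]
  exact h3 hx hy

theorem directionCode_congr {x : Ordinal.{u}} (hr : x < r.dom) (hr' : x < r'.dom)
    (h : ∀ ξ ≤ x, r.toFun ξ = r'.toFun ξ) :
    directionCode σ i τ b r x = directionCode σ i τ b r' x := by
  classical
  unfold directionCode
  exact if_congr (and_congr (iff_of_true hr hr') (Node.isJump_congr h))
    (if_congr (Node.isUpJump_congr h) rfl rfl) rfl

theorem valueCode_congr {x : Ordinal.{u}} (hr : x < r.dom) (hr' : x < r'.dom)
    (h : ∀ ξ ≤ x, r.toFun ξ = r'.toFun ξ) :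
    valueCode σ i τ b r x = valueCode σ i τ b r' x := by
  classical
  unfold valueCode
  exact if_congr (and_congr (iff_of_true hr hr') (Node.isJump_congr h))
    (by rw [h x le_rfl]) rfl

theorem directionCode_of_not_isJump {x : Ordinal.{u}} (h : ¬ Node.IsJump τ r x) :
    directionCode σ i τ b r x = b.toFun (codePoint σ x) :=
  if_neg fun h' => h h'.2

theorem directionCode_of_isUpJump {x : Ordinal.{u}} (hx : x < r.dom) (h : Node.IsJump τ r x)
    (hu : Node.IsUpJump τ r x) : directionCode σ i τ b r x = b.toFun (codePoint σ x) + 1 :=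
  (if_pos ⟨hx, h⟩).trans (if_pos hu)

theorem directionCode_of_not_isUpJump {x : Ordinal.{u}} (hx : x < r.dom)
    (h : Node.IsJump τ r x) (hu : ¬ Node.IsUpJump τ r x) : directionCode σ i τ b r x = i :=
  (if_pos ⟨hx, h⟩).trans (if_neg hu)

theorem valueCode_of_isJump {x : Ordinal.{u}} (hx : x < r.dom) (h : Node.IsJump τ r x) :
    valueCode σ i τ b r x = r.toFun x + i :=
  if_pos ⟨hx, h⟩

variable {T : Set (Node κ)}

theorem encode_mem (hκ : ℵ₀ ≤ κ) (hU : IsUniform T) (hb : b ∈ T) {η : Modification κ}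
    (hη : ∀ ξ < r.dom, (r.toFun ξ : ℤ) = η.toFun (η.prev ξ) + τ.toFun ξ) :
    encode σ i τ b r ∈ T := by
  classical
  have hlim := Cardinal.isSuccLimit_ord hκ
  let F := (η.dom.image (codePoint σ) ∪ η.dom.image fun x => codePoint σ x + 1).filter (· < κ.ord)
  refine hU.mem_of_eq_off_finite hκ F hb rfl (fun ζ hζ => ?_) fun ζ hζ hζF => ?_
  · obtain ⟨hζ, hζκ⟩ := Finset.mem_filter.1 hζ
    rcases Finset.mem_union.1 hζ with h | h
    · obtain ⟨x, -, rfl⟩ := Finset.mem_image.1 h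
      exact add_one_mem_naccCard hζκ
    · obtain ⟨x, -, rfl⟩ := Finset.mem_image.1 h
      exact add_one_mem_naccCard hζκ
  · have hζκ : ζ < κ.ord := hζ.trans b.dom_lt
    refine encode_cases (r := r) (r' := r) (motive := fun ζ v _ => v = b.toFun ζ) hζ
      ?_ ?_ fun _ _ => rfl
    · rintro x rfl
      refine if_neg fun h => hζF (Finset.mem_filter.2 ⟨Finset.mem_union_left _ ?_, hζκ⟩)
      exact Finset.mem_image_of_mem _ (η.mem_dom_of_isJump hη h.1 h.2)
    · rintro x rfl
      refine if_neg fun h => hζF (Finset.mem_filter.2 ⟨Finset.mem_union_right _ ?_, hζκ⟩)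
      exact Finset.mem_image_of_mem (fun x => codePoint σ x + 1)
        (η.mem_dom_of_isJump hη h.1 h.2)

theorem encode_iExt {s : Node κ} (hb : s.IExt i b) : s.IExt i (encode s.dom i τ b r) := by
  refine ⟨⟨hb.1.1, fun ξ hξ => ?_⟩, fun ξ h1 h2 => ?_⟩
  · rw [encode_of_ne (hξ.trans_le hb.1.1)]
    · exact hb.1.2 ξ hξ
    · exact fun x => (hξ.trans_le (le_codePoint _ x)).ne'
    · exact fun x => (hξ.trans ((le_codePoint _ x).trans_lt (lt_add_one _))).ne'
  · refine encode_cases (r := r) (r' := r) (motive := fun _ v _ => i ≤ v) h2 ?_ ?_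
      fun _ _ => hb.2 ξ h1 h2
    · rintro x rfl
      have := hb.2 _ h1 h2
      unfold directionCode
      split_ifs <;> omega
    · rintro x rfl
      have := hb.2 _ h1 h2
      unfold valueCode
      split_ifs <;> omega

/-- At the first difference of `r` and `r'`, the directions of the jumps are compared first; if
they agree, then both nodes have a jump, and the values decide. -/
theorem directionCode_lt_or {η : Modification κ}
    (hη : ∀ ξ < r.dom, (r.toFun ξ : ℤ) = η.toFun (η.prev ξ) + τ.toFun ξ)
    {x : Ordinal.{u}} (hr : x < r.dom) (hr' : x < r'.dom)
    (h : ∀ ξ < x, r.toFun ξ = r'.toFun ξ) (hx : r.toFun x < r'.toFun x)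
    (hb : i < b.toFun (codePoint σ x)) :
    directionCode σ i τ b r x < directionCode σ i τ b r' x ∨
      directionCode σ i τ b r x = directionCode σ i τ b r' x ∧
        valueCode σ i τ b r x < valueCode σ i τ b r' x := by
  have hd : Node.diff τ r x < Node.diff τ r' x := by
    simp only [Node.diff]
    omega
  rcases eq_or_ne x 0 with rfl | hx0
  · have hj : ∀ t : Node κ, Node.IsJump τ t 0 := fun t γ hγ => absurd hγ not_lt_zero
    have hu : ∀ t : Node κ, ¬ Node.IsUpJump τ t 0 := fun t ⟨γ, hγ, _⟩ => not_lt_zero hγ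
    rw [directionCode_of_not_isUpJump hr (hj r) (hu r),
      directionCode_of_not_isUpJump hr' (hj r') (hu r'), valueCode_of_isJump hr (hj r),
      valueCode_of_isJump hr' (hj r')]
    omega
  · obtain ⟨γ, hγ, v, hv⟩ := Modification.exists_const_below hη hr (pos_iff_ne_zero.2 hx0)
    have hv' : ∀ ξ, γ ≤ ξ → ξ < x → Node.diff τ r' ξ = v := fun ξ h1 h2 => by
      rw [← hv ξ h1 h2]
      simp only [Node.diff, h ξ h2]
    have hcode : ∀ t : Node κ, x < t.dom → (∀ ξ, γ ≤ ξ → ξ < x → Node.diff τ t ξ = v) →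
        (Node.diff τ t x < v ∧ directionCode σ i τ b t x = i ∧
          valueCode σ i τ b t x = t.toFun x + i) ∨
        (Node.diff τ t x = v ∧ directionCode σ i τ b t x = b.toFun (codePoint σ x)) ∨
        (v < Node.diff τ t x ∧ directionCode σ i τ b t x = b.toFun (codePoint σ x) + 1 ∧
          valueCode σ i τ b t x = t.toFun x + i) := by
      intro t ht htv
      have hj := Node.isJump_iff hγ htv
      have hu := Node.isUpJump_iff hγ htv
      rcases lt_trichotomy (Node.diff τ t x) v with hlt | heq | hlt
      · exact Or.inl ⟨hlt, directionCode_of_not_isUpJump ht (hj.2 hlt.ne')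
          fun h => (hu.1 h).not_gt hlt, valueCode_of_isJump ht (hj.2 hlt.ne')⟩
      · exact Or.inr (Or.inl ⟨heq, directionCode_of_not_isJump fun h => hj.1 h heq.symm⟩)
      · exact Or.inr (Or.inr ⟨hlt, directionCode_of_isUpJump ht (hj.2 hlt.ne) (hu.2 hlt),
          valueCode_of_isJump ht (hj.2 hlt.ne)⟩)
    have h1 := hcode r hr hv
    have h2 := hcode r' hr' hv'
    omega

theorem encode_branch {η η' : Modification κ}
    (hη : ∀ ξ < r.dom, (r.toFun ξ : ℤ) = η.toFun (η.prev ξ) + τ.toFun ξ)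
    (hη' : ∀ ξ < r'.dom, (r'.toFun ξ : ℤ) = η'.toFun (η'.prev ξ) + τ.toFun ξ)
    {δ : Ordinal.{u}} (hδ : Order.IsSuccLimit δ) (hσδ : ∀ x < δ, codePoint σ x + 1 < δ)
    (hbd : b.dom = δ + 1) (hb : ∀ ζ, σ ≤ ζ → ζ < b.dom → i < b.toFun ζ)
    (hrd : r.dom ≤ δ + 1) (h : r.Branch r') :
    (encode σ i τ b r).Branch (encode σ i τ b r') := by
  obtain ⟨x, hr, hr', hag, hx⟩ := h
  -- a jump is never at a limit ordinal, so that there is enough room above `x` for the code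
  have hxδ : x < δ := by
    refine lt_of_le_of_ne (Order.lt_add_one_iff.1 (hr.trans_le hrd)) ?_
    rintro rfl
    rcases Node.isJump_or_isJump (τ := τ) hag hx.ne with hj | hj
    · exact not_mem_naccCard_of_isSuccLimit hδ
        (η.dom_subset _ (η.mem_dom_of_isJump hη hr hj))
    · exact not_mem_naccCard_of_isSuccLimit hδ
        (η'.dom_subset _ (η'.mem_dom_of_isJump hη' hr' hj))
  have hq : codePoint σ x + 1 < b.dom := by
    rw [hbd]
    exact (hσδ x hxδ).trans (lt_add_one δ)
  have hp : codePoint σ x < b.dom := (lt_add_one _).trans hq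
  have hbelow : ∀ ζ < codePoint σ x,
      (encode σ i τ b r).toFun ζ = (encode σ i τ b r').toFun ζ := by
    intro ζ hζ
    refine encode_cases (motive := fun _ v w => v = w) (hζ.trans hp) ?_ ?_ fun _ _ => rfl
    · rintro y rfl
      have hyx : y < x := (codePoint_strictMono σ).lt_iff_lt.1 hζ
      exact directionCode_congr (hyx.trans hr) (hyx.trans hr') fun ξ hξ =>
        hag ξ (hξ.trans_lt hyx)
    · rintro y rfl
      have hyx : y < x := (codePoint_strictMono σ).lt_iff_lt.1 ((lt_add_one _).trans hζ)
      exact valueCode_congr (hyx.trans hr) (hyx.trans hr') fun ξ hξ =>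
        hag ξ (hξ.trans_lt hyx)
  rcases directionCode_lt_or (σ := σ) (i := i) (b := b) hη hr hr' hag hx
    (hb _ (le_codePoint σ x) hp) with hlt | ⟨heq, hlt⟩
  · refine ⟨codePoint σ x, hp, hp, hbelow, ?_⟩
    rwa [encode_codePoint hp, encode_codePoint hp]
  · refine ⟨codePoint σ x + 1, hq, hq, fun ζ hζ => ?_, ?_⟩
    · rcases (Order.lt_add_one_iff.1 hζ).eq_or_lt with rfl | hζ
      · rwa [encode_codePoint hp, encode_codePoint hp]
      · exact hbelow ζ hζ
    · rwa [encode_codePoint_add_one hq, encode_codePoint_add_one hq]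

/-- Every frozen cone contains a copy of the nodes of height at most `δ + 1`, on its level `δ + 1`,
for a suitable limit ordinal `δ`. -/
theorem exists_coding (hreg : κ.IsRegular) (hunc : ℵ₀ < κ) (hT : IsStreamlinedTree T)
    (hU : IsUniformlyCoherent T) {s : Node κ} (hs : s ∈ T) (hn : s.dom ∈ naccCard κ) (i : ℕ) :
    ∃ δ < κ.ord, ∃ φ : Node κ → Node κ,
      (∀ r ∈ T, r.dom ≤ δ + 1 → φ r ∈ T ∧ (φ r).dom = δ + 1 ∧ s.IExt i (φ r)) ∧
      ∀ r ∈ T, ∀ r' ∈ T, r.dom ≤ δ + 1 → r'.dom ≤ δ + 1 → r.Branch r' → (φ r).Branch (φ r') := by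
  obtain ⟨δ, hδκ, hδ, hsδ, hδc⟩ := exists_limit_closed hreg hunc s.dom_lt
  have hδ1 : δ + 1 < κ.ord := (Cardinal.isSuccLimit_ord hreg.aleph0_le).add_one_lt hδκ
  obtain ⟨τ, hτ, hτd⟩ := hT.level_nonempty (δ + 1) hδ1
  have hsτ : s.dom ≤ τ.dom := (hsδ.trans (lt_add_one δ).le).trans hτd.ge
  -- the shift by `i + 1` leaves room for coding downward jumps by the value `i`
  have hbT := hU.glue_mem hreg.aleph0_le hT hs hτ hsτ hn (i + 1)
  set b := s.glue τ (i + 1)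
  have hb : ∀ ζ, s.dom ≤ ζ → ζ < b.dom → i < b.toFun ζ := by
    intro ζ h1 h2
    have hζ : b.toFun ζ = τ.toFun ζ + (i + 1) := Node.glue_apply_of_le h2 h1
    omega
  have hmod : ∀ r ∈ T, r.dom ≤ δ + 1 → ∃ η : Modification κ,
      ∀ ξ < r.dom, (r.toFun ξ : ℤ) = η.toFun (η.prev ξ) + τ.toFun ξ := fun r hr hrd =>
    hU.1.exists_modification hT hr hτ (hrd.trans hτd.ge)
  refine ⟨δ, hδκ, encode s.dom i τ b, fun r hr hrd => ⟨?_, hτd, ?_⟩, ?_⟩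
  · obtain ⟨η, hη⟩ := hmod r hr hrd
    exact encode_mem hreg.aleph0_le hU.2 hbT hη
  · exact encode_iExt ⟨Node.sub_glue _ hsτ, fun ξ h1 h2 => (hb ξ h1 h2).le⟩
  · intro r hr r' hr' hrd hrd' hrr
    obtain ⟨η, hη⟩ := hmod r hr hrd
    obtain ⟨η', hη'⟩ := hmod r' hr' hrd'
    exact encode_branch hη hη' hδ hδc hτd hb hrd hrr

/-- The whole tree can be mapped into any of its frozen cones, so that incomparable nodes are sent
to incomparable nodes in the same order: the part of a node below `δ + 1` is replaced with its
code, and the part above is only shifted. -/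
theorem exists_map_into_frozenCone (hreg : κ.IsRegular) (hunc : ℵ₀ < κ) (hT : IsStreamlinedTree T)
    (hU : IsUniformlyCoherent T) {s : Node κ} (hs : s ∈ T) (hn : s.dom ∈ naccCard κ) (i : ℕ) :
    ∃ Φ : Node κ → Node κ, (∀ t ∈ T, Φ t ∈ frozenCone T s i) ∧
      ∀ t ∈ T, ∀ t' ∈ T, t.Branch t' → (Φ t).Branch (Φ t') := by
  classical
  obtain ⟨δ, hδκ, φ, hφ, hφb⟩ := exists_coding hreg hunc hT hU hs hn i
  have hδ1 : δ + 1 < κ.ord := (Cardinal.isSuccLimit_ord hreg.aleph0_le).add_one_lt hδκ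
  have htr : ∀ t ∈ T, t.trunc (δ + 1) ∈ T ∧ (t.trunc (δ + 1)).dom ≤ δ + 1 := fun t ht =>
    ⟨hT.trunc_mem ht _, min_le_right _ _⟩
  let φ' : Node κ → Node κ := fun t => φ (t.trunc (δ + 1))
  have hφ' : ∀ t ∈ T, φ' t ∈ T ∧ (φ' t).dom = δ + 1 ∧ s.IExt i (φ' t) := fun t ht =>
    hφ _ (htr t ht).1 (htr t ht).2
  let Φ : Node κ → Node κ := fun t => if δ + 1 ≤ t.dom then (φ' t).glue t i else φ' t
  have hΦ : ∀ t, δ + 1 ≤ t.dom → Φ t = (φ' t).glue t i := fun t h => if_pos h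
  have hsub : ∀ t ∈ T, (φ' t).Sub (Φ t) := by
    intro t ht
    by_cases h : δ + 1 ≤ t.dom
    · rw [hΦ t h]
      exact Node.sub_glue i ((hφ' t ht).2.1.trans_le h)
    · rw [show Φ t = φ' t from if_neg h]
      exact Node.Sub.refl _
  refine ⟨Φ, fun t ht => ?_, fun t ht t' ht' hb => ?_⟩
  · obtain ⟨h1, h2, h3⟩ := hφ' t ht
    by_cases h : δ + 1 ≤ t.dom
    · refine ⟨?_, Or.inr ⟨h3.1.trans (hsub t ht), fun ξ hξ hξt => ?_⟩⟩
      · rw [hΦ t h]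
        exact hU.glue_mem hreg.aleph0_le hT h1 ht (h2.trans_le h)
          (h2 ▸ add_one_mem_naccCard hδ1) i
      · rcases lt_or_ge ξ (φ' t).dom with hlt | hge
        · rw [← (hsub t ht).2 ξ hlt]
          exact h3.2 ξ hξ hlt
        · rw [hΦ t h] at hξt ⊢
          have hξt : ξ < t.dom := hξt
          rw [Node.glue_apply_of_le hξt hge]
          omega
    · rw [show Φ t = φ' t from if_neg h]
      exact ⟨h1, Or.inr h3⟩
  · obtain ⟨Δ, h1, h2, h3, h4⟩ := hb
    rcases lt_or_ge Δ (δ + 1) with hΔ | hΔ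
    · refine (hφb _ (htr t ht).1 _ (htr t' ht').1 (htr t ht).2 (htr t' ht').2
        ⟨Δ, lt_min h1 hΔ, lt_min h2 hΔ, fun ξ hξ => ?_, ?_⟩).mono (hsub t ht) (hsub t' ht')
      · rw [Node.trunc_apply (hξ.trans h1) (hξ.trans hΔ),
          Node.trunc_apply (hξ.trans h2) (hξ.trans hΔ), h3 ξ hξ]
      · rwa [Node.trunc_apply h1 hΔ, Node.trunc_apply h2 hΔ]
    · have hd := hΔ.trans h1.le
      have hd' := hΔ.trans h2.le
      have heq : t.trunc (δ + 1) = t'.trunc (δ + 1) := by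
        refine Node.ext_of_lt ((Node.trunc_dom hd).trans (Node.trunc_dom hd').symm) fun ξ hξ => ?_
        rw [Node.trunc_dom hd] at hξ
        rw [Node.trunc_apply (hξ.trans_le hd) hξ, Node.trunc_apply (hξ.trans_le hd') hξ,
          h3 ξ (hξ.trans_le hΔ)]
      have heq' : φ' t = φ' t' := congrArg φ heq
      have hdom := (hφ' t' ht').2.1
      rw [hΦ t hd, hΦ t' hd', heq']
      refine ⟨Δ, h1, h2, fun ξ hξ => ?_, ?_⟩
      · rcases lt_or_ge ξ (φ' t').dom with hlt | hge
        · rw [Node.glue_apply_of_lt (hξ.trans h1) hlt, Node.glue_apply_of_lt (hξ.trans h2) hlt]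
        · rw [Node.glue_apply_of_le (hξ.trans h1) hge, Node.glue_apply_of_le (hξ.trans h2) hge,
            h3 ξ hξ]
      · rw [Node.glue_apply_of_le h1 (hdom.trans_le hΔ),
          Node.glue_apply_of_le h2 (hdom.trans_le hΔ)]
        omega

end Encode

/-! ### Minimality -/

theorem mainTheorem2 (κ : Cardinal.{u}) (hreg : κ.IsRegular) (hunc : ℵ₀ < κ)
    (T : Set (Node κ)) (hA : IsAronszajnTree T) (hU : IsUniformlyCoherent T)
    (hS : ¬ IsSouslinTree T)
    (hfrozen : ∀ A : Set (Node κ), IsSubtree T A →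
      ∃ s ∈ treeRestrict T (naccCard κ), ∃ i : ℕ, frozenCone T s i ⊆ A) :
    ∀ X : Set (Node κ), X ⊆ T → IsAntichain Node.Sub X → #X = Cardinal.lift.{u + 1} κ →
      IsMinimalNonSigmaScattered X := by
  intro X hX hanti hcard
  constructor
  · rintro ⟨S, hSs, hSu⟩
    have hcover : X ⊆ ⋃ n, ((↑) '' S n : Set (Node κ)) := by
      rw [← image_iUnion, hSu, Subtype.coe_image_univ]
    obtain ⟨n, hn⟩ := (hA.1.isUnboundedSet_of_mk_eq hreg hX hcard).exists_of_subset_iUnion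
      hreg hunc hcover
    have hsub : ((↑) '' S n : Set (Node κ)) ⊆ T := by
      rintro _ ⟨x, -, rfl⟩
      exact hX x.2
    refine hA.not_isScattered hreg hsub hn ⟨fun f => (hSs n).false ?_⟩
    have hmem : ∀ q, ∃ x ∈ S n, x.1 = (f q).1 := fun q => (f q).2
    choose g hg hgf using hmem
    refine OrderEmbedding.ofStrictMono (fun q => (⟨g q, hg q⟩ : S n)) fun q r hqr => ?_
    have hlt : (f q).1 < (f r).1 := f.lt_iff_lt.2 hqr
    rw [← hgf, ← hgf] at hlt
    exact hlt
  · intro Y hY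
    -- `Y` as a set of nodes
    let Y' : Set (Node κ) := (↑) '' Y
    have hYX : Y' ⊆ X := by
      rintro _ ⟨x, -, rfl⟩
      exact x.2
    have hu : IsUnboundedSet Y' := by
      by_contra h
      obtain ⟨ρ, hρ, hb⟩ := exists_bound_of_not_isUnboundedSet h
      obtain ⟨S, hSs, hSu⟩ := hU.1.isSigmaScattered_of_bounded hA.1 (hYX.trans hX) hρ
        fun y hy => (hb y hy).le
      let j : Y → Y' := fun y => ⟨y.1.1, y.1, y.2, rfl⟩
      refine hY ⟨fun n => j ⁻¹' S n, fun n => ⟨fun f => (hSs n).false ?_⟩, ?_⟩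
      · exact OrderEmbedding.ofStrictMono (fun q => (⟨j (f q).1, (f q).2⟩ : S n))
          fun q r hqr => f.lt_iff_lt.2 hqr
      · rw [← preimage_iUnion, hSu, preimage_univ]
    obtain ⟨s, hs, i, hsi⟩ := hfrozen _ (isSubtree_downClosure hA.1 (hYX.trans hX) hu)
    obtain ⟨Φ, hΦ, hΦb⟩ := exists_map_into_frozenCone hreg hunc hA.1 hU hs.1 hs.2 i
    have hex : ∀ x : X, ∃ y : Y, (Φ x.1).Sub y.1.1 := by
      intro x
      obtain ⟨-, _, ⟨y, hy, rfl⟩, hxy⟩ := hsi (hΦ x.1 (hX x.2))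
      exact ⟨⟨y, hy⟩, hxy⟩
    choose g hg using hex
    refine ⟨OrderEmbedding.ofStrictMono g fun x x' hxx => ?_⟩
    have hb : x.1.Branch x'.1 := Node.branch_of_lt hxx fun h =>
      hanti x.2 x'.2 (fun h' => hxx.ne (Subtype.ext h')) h
    exact ((hΦb _ (hX x.2) _ (hX x'.2) hb).mono (hg x) (hg x')).lt
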